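/- Consider an asynchronous system of processes that communicate only through atomic read/write registers. A timestamp object has two methods: getTS(), which returns a timestamp, and compare($t_1,t_2$), which takes any two timestamps and returns true or false. Correctness means: if a getTS call that returns $t_1$ responds before the invocation of a getTS call that returns $t_2$, then every call compare($t_1,t_2$) returns true and every call compare($t_2,t_1$) returns false. The object is one-shot if each process may call getTS at most once; calls of compare are never restricted. An implementation is wait-free if every method call responds within a bounded number of its caller's own steps, whatever the other processes do. **Theorem.** (1) For every $n\ge 0$ there is a wait-free implementation of one-shot timestamp objects for $n$ processes that uses at most $\lceil 2\sqrt n\,\rceil$, and hence at most $2\lceil\sqrt n\,\rceil$, registers. (2) More generally, let $M\ge 0$ and $m=\lceil 2\sqrt M\,\rceil$, and consider the following algorithm for an arbitrary set of processes. Timestamps are pairs $(rnd,turn)$ of natural numbers, and compare($(rnd_1,turn_1),(rnd_2,turn_2)$) returns the truth value of $rnd_1<rnd_2\vee(rnd_1=rnd_2\wedge turn_1<turn_2)$, without accessing shared memory. The shared registers $R[1],R[2],\dots$ hold $\bot$ (initially) or a pair $\langle seq,rnd\rangle$ of a sequence of call identifiers and a number; $last(\cdot)$ is the last element of a sequence.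 The $k$-th getTS call of process $p$ has identifier $ID=p.k$ and, with local variables $r[1],r[2],\dots$ (initially $\bot$), $j$ and $myrnd$, does the following. - Starting from $j=1$, while $R[j]\ne\bot$: set $r[j]:=R[j]$ and $j:=j+1$. Then set $myrnd:=j-1$. - For $j=1,\dots,myrnd-1$: if $R[myrnd+1]\neq\bot$, return $(myrnd+1,0)$. Otherwise, if $r[myrnd].seq[j]=last(R[j].seq)$, write $R[j]:=\langle(ID),myrnd\rangle$ and return $(myrnd,j)$; else, if $R[j].rnd<myrnd$, write $R[j]:=\langle(ID),myrnd\rangle$. - Set $r[1..m]$ to the result of a scan of $R[1],\dots,R[m]$, which reads $R[1],\dots,R[m]$ one after another, repeatedly, until two contiguous passes give identical views. If $r[myrnd+1]=\bot$, write $R[myrnd+1]:=\langle(last(r[1].seq),\dots,last(r[myrnd].seq),ID),\,myrnd+1\rangle$. Return $(myrnd+1,0)$. (Each evaluation of a shared register is a separate atomic read.) Then, over all executions with at most $M$ getTS invocations in total (by any processes, each possibly calling repeatedly) and arbitrarily many compare calls, the algorithm is a correct timestamp object, it accesses no registers other than $R[1],\dots,R[m]$, and it is wait-free. -/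

import Mathlib

namespace TimestampObject

/-! ### Asynchronous shared memory and timestamp objects -/

/-- The operations of a timestamp object with timestamp universe `T`. -/
inductive Op (T : Type*) where
  | getTS
  | compare (t₁ t₂ : T)

/-- The responses of method calls. -/
inductive Result (T : Type*) where
  | stamp (t : T)
  | bool (b : Bool)

/-- What a process inside a method call does next: one atomic read or one atomic write of a shared
register, or the response of the call. Local computation is part of the adjacent step. -/
inductive Action (Reg Val T State : Type*) where
  | read (r : Reg) (cont : Val → State)
  | write (r : Reg) (v : Val) (cont : State)
  | ret (res : Result T) (cont : State)

/-- A (deterministic) implementation of the operations `getTS` and `compare` from atomic registers.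
`start p` is the local state of process `p` before its first call, `invoke op s` is the local state
with which a process whose local state is `s` begins a call of `op`, and `next s` is the next step
of a process that is inside a call with local state `s`. -/
structure Implementation (Proc Reg Val T State : Type*) where
  initVal : Reg → Val
  start : Proc → State
  invoke : Op T → State → State
  next : State → Action Reg Val T State

/-- A configuration: the contents of the registers, the local states of the processes, and which
processes are inside a method call. -/
structure Config (Proc Reg Val State : Type*) where
  mem : Reg → Val
  loc : Proc → State
  busy : Proc → Bool

/-- The events of an execution: invocations, atomic reads (with the value read), atomic writes
(with the value written), and responses. -/
inductive Event (Proc Reg Val T : Type*) where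
  | invoke (p : Proc) (op : Op T)
  | read (p : Proc) (r : Reg) (v : Val)
  | write (p : Proc) (r : Reg) (v : Val)
  | respond (p : Proc) (res : Result T)

namespace Event

variable {Proc Reg Val T : Type*}

/-- The process that performs an event. -/
def proc : Event Proc Reg Val T → Proc
  | invoke p _ => p
  | read p _ _ => p
  | write p _ _ => p
  | respond p _ => p

/-- The register that is accessed (read or written) by an event, if any. -/
def reg? : Event Proc Reg Val T → Option Reg
  | invoke _ _ => none
  | read _ r _ => some r
  | write _ r _ => some r
  | respond _ _ => none

/-- The event is an invocation of `getTS`. -/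
def isGetTS : Event Proc Reg Val T → Bool
  | invoke _ .getTS => true
  | _ => false

/-- The event is a response. -/
def isResponse : Event Proc Reg Val T → Bool
  | respond _ _ => true
  | _ => false

end Event

/-- In the trace `L`, the event number `i` invokes `op`, and event number `j` is the response `res`
of that very call. -/
def CompletedCall {Proc Reg Val T : Type*} (L : List (Event Proc Reg Val T)) (i j : ℕ)
    (op : Op T) (res : Result T) : Prop :=
  ∃ p : Proc, i < j ∧ L[i]? = some (.invoke p op) ∧ L[j]? = some (.respond p res) ∧
    ∀ k, i < k → k < j → ∀ res', L[k]? ≠ some (.respond p res')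

/-- The specification of timestamp objects, for a single trace. Every completed call of `getTS`
returns a timestamp, every completed call of `compare` returns a truth value, and whenever a
call of `getTS` that returns `t₁` happens before (its response precedes the invocation of) a call of
`getTS` that returns `t₂`, all calls `compare t₁ t₂` return true and all calls `compare t₂ t₁`
return false. -/
def TimestampSpec {Proc Reg Val T : Type*} (L : List (Event Proc Reg Val T)) : Prop :=
  (∀ i j res, CompletedCall L i j .getTS res → ∃ t, res = .stamp t) ∧
  (∀ i j t t' res, CompletedCall L i j (.compare t t') res → ∃ b, res = .bool b) ∧
  (∀ i₁ j₁ i₂ j₂ t₁ t₂, CompletedCall L i₁ j₁ .getTS (.stamp t₁) →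
    CompletedCall L i₂ j₂ .getTS (.stamp t₂) → j₁ < i₂ →
    (∀ i j b, CompletedCall L i j (.compare t₁ t₂) (.bool b) → b = true) ∧
    (∀ i j b, CompletedCall L i j (.compare t₂ t₁) (.bool b) → b = false))

/-- At most `M` invocations of `getTS` in total (and arbitrarily many of `compare`). -/
def AtMostGetTS {Proc Reg Val T : Type*} (M : ℕ) (L : List (Event Proc Reg Val T)) : Prop :=
  L.countP (fun e => e.isGetTS) ≤ M

/-- Each process invokes `getTS` at most once (and `compare` arbitrarily often). -/
def OneShot {Proc Reg Val T : Type*} [DecidableEq Proc] (L : List (Event Proc Reg Val T)) : Prop :=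
  ∀ p : Proc, L.countP (fun e => e.isGetTS && decide (e.proc = p)) ≤ 1

namespace Implementation

variable {Proc Reg Val T State : Type*} [DecidableEq Proc] [DecidableEq Reg]

/-- The initial configuration. -/
def init (I : Implementation Proc Reg Val T State) : Config Proc Reg Val State where
  mem := I.initVal
  loc := I.start
  busy := fun _ => false

/-- One step of the system. A process outside all method calls may invoke any operation at any
time; a process inside a call can always take the next step of its program. -/
inductive Step (I : Implementation Proc Reg Val T State) :
    Config Proc Reg Val State → Event Proc Reg Val T → Config Proc Reg Val State → Prop where
  | invoke (C : Config Proc Reg Val State) (p : Proc) (op : Op T) (hp : C.busy p = false) :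
      Step I C (.invoke p op)
        { mem := C.mem
          loc := Function.update C.loc p (I.invoke op (C.loc p))
          busy := Function.update C.busy p true }
  | read (C : Config Proc Reg Val State) (p : Proc) (r : Reg) (cont : Val → State)
      (hp : C.busy p = true) (hs : I.next (C.loc p) = .read r cont) :
      Step I C (.read p r (C.mem r))
        { mem := C.mem
          loc := Function.update C.loc p (cont (C.mem r))
          busy := C.busy }
  | write (C : Config Proc Reg Val State) (p : Proc) (r : Reg) (v : Val) (cont : State)
      (hp : C.busy p = true) (hs : I.next (C.loc p) = .write r v cont) :
      Step I C (.write p r v)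
        { mem := Function.update C.mem r v
          loc := Function.update C.loc p cont
          busy := C.busy }
  | respond (C : Config Proc Reg Val State) (p : Proc) (res : Result T) (cont : State)
      (hp : C.busy p = true) (hs : I.next (C.loc p) = .ret res cont) :
      Step I C (.respond p res)
        { mem := C.mem
          loc := Function.update C.loc p cont
          busy := Function.update C.busy p false }

/-- `I.Exec L C`: there is a finite execution of `I` from the initial configuration with trace `L`
that ends in configuration `C`. -/
inductive Exec (I : Implementation Proc Reg Val T State) :
    List (Event Proc Reg Val T) → Config Proc Reg Val State → Prop where
  | nil : Exec I [] I.init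
  | snoc {L : List (Event Proc Reg Val T)} {C C' : Config Proc Reg Val State}
      {e : Event Proc Reg Val T} (h : Exec I L C) (hs : I.Step C e C') : Exec I (L ++ [e]) C'

/-- `L` is the trace of a finite execution of `I` that starts in the initial configuration. -/
def IsTrace (I : Implementation Proc Reg Val T State) (L : List (Event Proc Reg Val T)) : Prop :=
  ∃ C, I.Exec L C

/-- `I` implements a timestamp object, as long as executions obey the usage restriction `adm`. -/
def ImplementsTimestamps (I : Implementation Proc Reg Val T State)
    (adm : List (Event Proc Reg Val T) → Prop) : Prop :=
  ∀ L, I.IsTrace L → adm L → TimestampSpec L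

/-- Wait-freedom, with a uniform bound `B`: whatever the other processes do, no process takes more
than `B` steps inside a method call before it responds. -/
def WaitFree (I : Implementation Proc Reg Val T State)
    (adm : List (Event Proc Reg Val T) → Prop) : Prop :=
  ∃ B : ℕ, ∀ (L₁ L₂ : List (Event Proc Reg Val T)) (p : Proc) (op : Op T),
    I.IsTrace (L₁ ++ .invoke p op :: L₂) → adm (L₁ ++ .invoke p op :: L₂) →
    (∀ e ∈ L₂, e.proc = p → e.isResponse = false) →
    L₂.countP (fun e => decide (e.proc = p)) ≤ B

/-- Only registers in `S` are ever accessed. -/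
def AccessesOnly (I : Implementation Proc Reg Val T State)
    (adm : List (Event Proc Reg Val T) → Prop) (S : Finset Reg) : Prop :=
  ∀ L, I.IsTrace L → adm L → ∀ e ∈ L, ∀ r, e.reg? = some r → r ∈ S

/-- At most `k` registers are used. -/
def UsesAtMost (I : Implementation Proc Reg Val T State)
    (adm : List (Event Proc Reg Val T) → Prop) (k : ℕ) : Prop :=
  ∃ S : Finset Reg, S.card ≤ k ∧ I.AccessesOnly adm S

end Implementation

/-! ### The algorithm -/

/-- The getTS-id `p.k` of the `k`-th call of `getTS` by process `p`. -/
abbrev ID (Proc : Type*) := Proc × ℕ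

/-- Register contents: `⊥` (that is, `none`), or a pair `⟨seq, rnd⟩`. -/
abbrev Content (Proc : Type*) := Option (List (ID Proc) × ℕ)

/-- A local array `r[1], r[2], …` of register contents. -/
abbrev View (Proc : Type*) := ℕ → Content Proc

section Algorithm

variable {Proc : Type*}

/-- `last(x.seq)`. -/
def lastOf (x : Content Proc) : Option (ID Proc) := x.bind fun c => c.1.getLast?

/-- `x.seq[j]` (counting from `1`). -/
def entry (x : Content Proc) (j : ℕ) : Option (ID Proc) := x.bind fun c => c.1[j - 1]?

/-- `x.rnd`. -/
def rndOf (x : Content Proc) : ℕ := (x.map Prod.snd).getD 0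

/-- The sequence `(last(r[1].seq), …, last(r[k].seq))`. -/
def lasts (r : View Proc) (k : ℕ) : List (ID Proc) :=
  (List.range k).filterMap fun i => lastOf (r (i + 1))

variable (Proc) in
/-- The program counter of a process, with the local variables of the current call. Each point
stands right before one shared memory access or right before a response:
```
getTS(ID):                                            -- r[1..m] = ⊥, j = 1
 1  while R[j] ≠ ⊥
 2      r[j] = R[j]
 3      j = j + 1
 4  myrnd = j - 1
 5  for j = 1 … myrnd - 1
 6      if R[myrnd + 1] == ⊥
 7          if r[myrnd].seq[j] == last(R[j].seq)
 8              R[j] = ⟨(ID), myrnd⟩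
 9              return (myrnd, j)
10          else if R[j].rnd < myrnd
11              R[j] = ⟨(ID), myrnd⟩
        else
12          return (myrnd + 1, 0)
13  r[1..m] = scan(R[1], …, R[m])
14  if r[myrnd + 1] == ⊥
15      R[myrnd + 1] = ⟨(last(r[1].seq), …, last(r[myrnd].seq), ID), myrnd + 1⟩
16  return (myrnd + 1, 0)
```
-/
inductive PC where
  | idle
  | line1 (r : View Proc) (j : ℕ)
  | line2 (r : View Proc) (j : ℕ)
  | line6 (r : View Proc) (myrnd j : ℕ)
  | line7 (r : View Proc) (myrnd j : ℕ)
  | line8 (myrnd j : ℕ)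
  | line10 (r : View Proc) (myrnd j : ℕ)
  | line11 (r : View Proc) (myrnd j : ℕ)
  /-- Inside the scan: about to read `R[j]` in the current collect; `prev` is the view of the
  previous collect, if there is one, and `cur` is the part of the current view read so far. -/
  | line13 (myrnd : ℕ) (prev : Option (View Proc)) (cur : View Proc) (j : ℕ)
  | line15 (r : View Proc) (myrnd : ℕ)
  | retTS (t : ℕ × ℕ)
  | compare (t₁ t₂ : ℕ × ℕ)

/-- The start of the scan. -/
def startScan (myrnd : ℕ) : PC Proc := .line13 myrnd none (fun _ => none) 1

/-- The head of the for-loop: enter iteration `j` if `j ≤ myrnd - 1`, otherwise go on to the scan. -/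
def forLoop (r : View Proc) (myrnd j : ℕ) : PC Proc :=
  if j < myrnd then .line6 r myrnd j else startScan myrnd

/-- The local step after reading the value `v` from `R[j]` during the scan of `R[1], …, R[m]`: the
collects are repeated until two contiguous ones return the same view. -/
def afterScanRead [DecidableEq Proc] (m myrnd : ℕ) (prev : Option (View Proc)) (cur : View Proc)
    (j : ℕ) (v : Content Proc) : PC Proc :=
  let view := Function.update cur j v
  if j < m then .line13 myrnd prev view (j + 1)
  else if ∃ old ∈ prev, ∀ i ∈ Finset.Icc 1 m, old i = view i then
    if view (myrnd + 1) = none then .line15 view myrnd else .retTS (myrnd + 1, 0)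
  else .line13 myrnd (some view) (fun _ => none) 1

/-- The lexicographic comparison of timestamps. -/
def compareTS (t₁ t₂ : ℕ × ℕ) : Bool :=
  decide (t₁.1 < t₂.1 ∨ (t₁.1 = t₂.1 ∧ t₁.2 < t₂.2))

variable (Proc) in
/-- The local state of a process: its name, the number of calls of `getTS` it has made so far, and
its program counter. -/
structure Local where
  name : Proc
  calls : ℕ
  pc : PC Proc

/-- The identifier of the current call of `getTS`. -/
def Local.id (s : Local Proc) : ID Proc := (s.name, s.calls)

variable (Proc) in
/-- The algorithm, with a scan over `m` registers. The shared registers are `R[1], R[2], …`;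
which of them are accessed is determined by the program. -/
def algorithm [DecidableEq Proc] (m : ℕ) :
    Implementation Proc ℕ (Content Proc) (ℕ × ℕ) (Local Proc) where
  initVal := fun _ => none
  start := fun p => { name := p, calls := 0, pc := .idle }
  invoke := fun op s =>
    match op with
    | .getTS => { s with calls := s.calls + 1, pc := .line1 (fun _ => none) 1 }
    | .compare t₁ t₂ => { s with pc := .compare t₁ t₂ }
  next := fun s =>
    match s.pc with
    -- never executed: an idle process is not inside a call
    | .idle => .ret (.bool false) s
    | .line1 r j => .read j fun v =>
        { s with pc := if v = none then forLoop r (j - 1) 1 else .line2 r j }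
    | .line2 r j => .read j fun v => { s with pc := .line1 (Function.update r j v) (j + 1) }
    | .line6 r myrnd j => .read (myrnd + 1) fun v =>
        { s with pc := if v = none then .line7 r myrnd j else .retTS (myrnd + 1, 0) }
    | .line7 r myrnd j => .read j fun v =>
        { s with pc := if entry (r myrnd) j = lastOf v then .line8 myrnd j
                       else .line10 r myrnd j }
    | .line8 myrnd j => .write j (some ([s.id], myrnd)) { s with pc := .retTS (myrnd, j) }
    | .line10 r myrnd j => .read j fun v =>
        { s with pc := if rndOf v < myrnd then .line11 r myrnd j else forLoop r myrnd (j + 1) }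
    | .line11 r myrnd j => .write j (some ([s.id], myrnd))
        { s with pc := forLoop r myrnd (j + 1) }
    | .line13 myrnd prev cur j => .read j fun v =>
        { s with pc := afterScanRead m myrnd prev cur j v }
    | .line15 r myrnd => .write (myrnd + 1) (some (lasts r myrnd ++ [s.id], myrnd + 1))
        { s with pc := .retTS (myrnd + 1, 0) }
    | .retTS t => .ret (.stamp t) { s with pc := .idle }
    | .compare t₁ t₂ => .ret (.bool (compareTS t₁ t₂)) { s with pc := .idle }

end Algorithm

end TimestampObject

/-! The nonempty registers always form an initial segment, and a call with `myrnd = ψ` has seen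
`R[1..ψ]` filled and, afterwards, `R[ψ+1]` empty. Hence the rounds of consecutive calls never
decrease. Within round `ψ`, a call returns `(ψ, j)` only if `R[j]` still ends with the identifier
recorded in `R[ψ]` by a scan taken while `R[ψ]` was empty. A call writes each register at most once
and identifiers determine calls, so equal last identifiers exclude writes in between (no ABA). A
finished call that returned `(ψ, j)` has, for every `j' ≤ j`, made or found the round of `R[j']` at
least `ψ`; such contents cannot predate the filling of `R[ψ]`, so no later call returns `(ψ, j')`
(`stamp_lt`).

The heart is the space bound `four_mul_card_ge`: filling `R[m]` takes more than `m² / 4` calls. Stop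
when `R[m]` is first filled, and cut time at `σ 1 < … < σ m`, where `σ φ` is the earliest scan that
opens round `φ`. The call that scans at `σ (φ+1)` has found every `R[j]` with `j < φ` changed since
a scan of round `φ`. So in interval `φ < m` each `R[j]` with `j ≤ φ` is written, and in the last
interval `R[m]` is. These pairs are charged to calls, two slots per call. Usually the first write to
`R[j]` in the interval pays, if it is the final write of its call. Otherwise it is an invalidation
by a call of round `φ - 1`. Either that call read `R[j]` before `σ φ` and wrote after it, which
happens at most once per call; or `R[j]` carried an outdated round at `σ φ`, and then the final
write of another call, which was not the first to `R[j]` in interval `φ - 1`, pays. Together with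
one opening scan per interval this makes `(m² + m + 2) / 2` pairs for two slots per call. If `4 * M
≤ m²`, then `R[m]` stays empty forever, which bounds all accesses and makes every scan cover the
registers that matter.

For wait-freedom, there are at most `M * m` writes in all, and each failed comparison of two
collects is paid for by a write during them. -/

namespace TimestampObject

/-! ### Executions as sequences of configurations indexed by time -/

section Runs

variable {Proc Reg Val T State : Type*}

/-- The call of `op` that process `p` invokes with event number `s` is pending right before event
number `t`. -/
def InCall (L : List (Event Proc Reg Val T)) (s t : ℕ) (p : Proc) (op : Op T) : Prop :=
  s < t ∧ L[s]? = some (.invoke p op) ∧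
    ∀ u, s < u → u < t → ∀ res, L[u]? ≠ some (.respond p res)

theorem InCall.mono {L : List (Event Proc Reg Val T)} {s t u : ℕ} {p : Proc} {op : Op T}
    (h : InCall L s t p op) (hu : s < u) (hut : u ≤ t) : InCall L s u p op :=
  ⟨hu, h.2.1, fun v hv hvu => h.2.2 v hv (hvu.trans_le hut)⟩

/-- Process `p` performs no write in the time interval `[a, b)`. -/
def Quiet (L : List (Event Proc Reg Val T)) (p : Proc) (a b : ℕ) : Prop :=
  ∀ u, a ≤ u → u < b → ∀ i v, L[u]? ≠ some (.write p i v)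

theorem Quiet.refl (L : List (Event Proc Reg Val T)) (p : Proc) (a : ℕ) : Quiet L p a a :=
  fun _ h1 h2 => absurd (h1.trans_lt h2) (lt_irrefl _)

theorem Quiet.succ {L : List (Event Proc Reg Val T)} {p : Proc} {a b : ℕ} (h : Quiet L p a b)
    (hb : ∀ i v, L[b]? ≠ some (.write p i v)) : Quiet L p a (b + 1) := by
  intro u h1 h2
  rcases Nat.lt_succ_iff_lt_or_eq.1 h2 with h3 | rfl
  · exact h u h1 h3
  · exact hb

theorem Quiet.lt_of_write {L : List (Event Proc Reg Val T)} {p : Proc} {a b u : ℕ}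
    (h : Quiet L p a b) (hu : u < b) {i : Reg} {v : Val} (hw : L[u]? = some (.write p i v)) :
    u < a := by
  by_contra hc
  exact h u (not_lt.1 hc) hu i v hw

/-- Some process writes register `j` with event number `w`. -/
def WriteTo (L : List (Event Proc Reg Val T)) (w : ℕ) (j : Reg) : Prop :=
  ∃ p v, L[w]? = some (.write p j v)

variable [DecidableEq Proc] [DecidableEq Reg]

/-- `C 0, C 1, …` are the configurations of the execution with trace `L`; the sequence is constant
after the end of the trace. -/
structure IsRun (I : Implementation Proc Reg Val T State) (L : List (Event Proc Reg Val T))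
    (C : ℕ → Config Proc Reg Val State) : Prop where
  zero : C 0 = I.init
  step : ∀ {t e}, L[t]? = some e → I.Step (C t) e (C (t + 1))
  stutter : ∀ {t}, L[t]? = none → C (t + 1) = C t

theorem Implementation.Exec.exists_isRun {I : Implementation Proc Reg Val T State}
    {L : List (Event Proc Reg Val T)} {D : Config Proc Reg Val State} (h : I.Exec L D) :
    ∃ C, IsRun I L C ∧ ∀ t, L.length ≤ t → C t = D := by
  induction h with
  | nil => exact ⟨fun _ => I.init, ⟨rfl, by simp, fun _ => rfl⟩, fun _ _ => rfl⟩
  | @snoc L D D' e _ hs ih =>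
    obtain ⟨C, hC, hD⟩ := ih
    refine ⟨fun t => if t ≤ L.length then C t else D', ⟨?_, ?_, ?_⟩, ?_⟩
    · simp [hC.zero]
    · intro t e' he
      rcases lt_trichotomy t L.length with ht | ht | ht
      · rw [List.getElem?_append_left ht] at he
        have h1 : t ≤ L.length := ht.le
        have h2 : t + 1 ≤ L.length := ht
        simpa [h1, h2] using hC.step he
      · subst ht
        have : e = e' := by simpa using he
        subst this
        simpa [hD L.length le_rfl] using hs
      · rw [List.getElem?_eq_none (by simp; omega)] at he
        cases he
    · intro t ht
      have : L.length < t := by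
        have := List.getElem?_eq_none_iff.1 ht
        simp at this
        omega
      have h1 : ¬ t ≤ L.length := by omega
      have h2 : ¬ t + 1 ≤ L.length := by omega
      simp [h1, h2]
    · intro t ht
      have : ¬ t ≤ L.length := by
        simp at ht
        omega
      simp [this]

theorem Implementation.IsTrace.exists_isRun {I : Implementation Proc Reg Val T State}
    {L : List (Event Proc Reg Val T)} (h : I.IsTrace L) : ∃ C, IsRun I L C :=
  let ⟨_, hD⟩ := h
  let ⟨C, hC, _⟩ := hD.exists_isRun
  ⟨C, hC⟩

namespace IsRun

variable {I : Implementation Proc Reg Val T State} {L : List (Event Proc Reg Val T)}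
  {C : ℕ → Config Proc Reg Val State}

theorem loc_succ_of_ne (h : IsRun I L C) {t : ℕ} {p : Proc}
    (hp : ∀ e, L[t]? = some e → e.proc ≠ p) :
    (C (t + 1)).loc p = (C t).loc p ∧ (C (t + 1)).busy p = (C t).busy p := by
  rcases he : L[t]? with _ | e
  · simp [h.stutter he]
  · have hs := h.step he
    have hpe : p ≠ e.proc := (hp e he).symm
    clear hp
    generalize C (t + 1) = D at hs
    generalize C t = D₀ at hs
    cases hs <;> simp_all [Event.proc]

theorem mem_succ_of_not_writeTo (h : IsRun I L C) {t : ℕ} {j : Reg} (hw : ¬ WriteTo L t j) :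
    (C (t + 1)).mem j = (C t).mem j := by
  rcases he : L[t]? with _ | e
  · simp [h.stutter he]
  · have hs := h.step he
    have hj : ∀ p v, e ≠ .write p j v := fun p v hc => hw ⟨p, v, hc ▸ he⟩
    generalize C (t + 1) = D at hs
    generalize C t = D₀ at hs
    cases hs <;> try rfl
    rename_i p r v _ _ _
    have : j ≠ r := fun hc => hj p v (hc ▸ rfl)
    simp [Function.update_of_ne this]

theorem mem_succ_of_write (h : IsRun I L C) {t : ℕ} {j : Reg} {p : Proc} {v : Val}
    (hw : L[t]? = some (.write p j v)) : (C (t + 1)).mem j = v := by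
  have hs := h.step hw
  generalize C (t + 1) = D at hs
  generalize C t = D₀ at hs
  cases hs
  simp

theorem mem_eq_of_no_write (h : IsRun I L C) {a b : ℕ} (hab : a ≤ b) {j : Reg}
    (hw : ∀ u, a ≤ u → u < b → ¬ WriteTo L u j) : (C b).mem j = (C a).mem j := by
  induction b, hab using Nat.le_induction with
  | base => rfl
  | succ b hab ih =>
    rw [h.mem_succ_of_not_writeTo (hw b hab b.lt_succ_self)]
    exact ih fun u h1 h2 => hw u h1 (h2.trans b.lt_succ_self)

theorem exists_write_of_ne (h : IsRun I L C) {a b : ℕ} (hab : a ≤ b) {j : Reg}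
    (hne : (C a).mem j ≠ (C b).mem j) : ∃ w, a ≤ w ∧ w < b ∧ WriteTo L w j := by
  by_contra! hc
  exact hne (h.mem_eq_of_no_write hab hc).symm

/-- If register `j` has been written since time `a`, then there is a last such write. -/
theorem exists_last_write (h : IsRun I L C) {a b : ℕ} {j : Reg}
    (hw : ∃ u, a ≤ u ∧ u < b ∧ WriteTo L u j) :
    ∃ w p, a ≤ w ∧ w < b ∧ L[w]? = some (.write p j ((C b).mem j)) ∧
      ∀ u, w < u → u < b → ¬ WriteTo L u j := by
  classical
  obtain ⟨u, hau, hub, hu⟩ := hw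
  -- `k` counts backwards from `b - 1`, so the least `k` gives the last write.
  have hP : ∃ k, k < b ∧ WriteTo L (b - 1 - k) j ∧ a ≤ b - 1 - k :=
    ⟨b - 1 - u, by omega, by rwa [show b - 1 - (b - 1 - u) = u by omega], by omega⟩
  obtain ⟨hk, ⟨p, v, hv⟩, hak⟩ := Nat.find_spec hP
  set k := Nat.find hP with hkdef
  have hlast : ∀ u, b - 1 - k < u → u < b → ¬ WriteTo L u j := by
    intro u h1 h2 h3
    refine Nat.find_min hP (m := b - 1 - u) (by omega) ⟨by omega, ?_, by omega⟩
    rwa [show b - 1 - (b - 1 - u) = u by omega]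
  refine ⟨b - 1 - k, p, hak, by omega, ?_, hlast⟩
  rw [h.mem_eq_of_no_write (a := b - 1 - k + 1) (by omega) fun u h1 h2 => hlast u (by omega) h2,
    h.mem_succ_of_write hv, hv]

theorem exists_last_write_of_ne (h : IsRun I L C) {a b : ℕ} (hab : a ≤ b) {j : Reg}
    (hne : (C a).mem j ≠ (C b).mem j) :
    ∃ w p, a ≤ w ∧ w < b ∧ L[w]? = some (.write p j ((C b).mem j)) ∧
      ∀ u, w < u → u < b → ¬ WriteTo L u j :=
  h.exists_last_write (h.exists_write_of_ne hab hne)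

theorem busy_of_inCall (h : IsRun I L C) {s t : ℕ} {p : Proc} {op : Op T}
    (hc : InCall L s t p op) : (C t).busy p = true := by
  obtain ⟨hst, hs, hr⟩ := hc
  induction t, hst using Nat.le_induction with
  | base =>
    have hs := h.step hs
    generalize C (s + 1) = D at hs
    generalize C s = D₀ at hs
    cases hs
    simp
  | succ t hst ih =>
    have ih := ih fun u h1 h2 => hr u h1 (h2.trans t.lt_succ_self)
    by_cases hp : ∀ e, L[t]? = some e → e.proc ≠ p
    · rw [(h.loc_succ_of_ne hp).2, ih]
    · push Not at hp
      obtain ⟨e, he, hep⟩ := hp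
      have hstep := h.step he
      have hres : ∀ res, e ≠ .respond p res := fun res hc =>
        hr t (by omega) t.lt_succ_self res (hc ▸ he)
      generalize C (t + 1) = D at hstep
      generalize C t = D₀ at hstep ih
      cases hstep <;> simp_all [Event.proc]

theorem exists_inCall (h : IsRun I L C) {t : ℕ} {p : Proc} (hb : (C t).busy p = true) :
    ∃ s op, InCall L s t p op := by
  induction t with
  | zero => simp [h.zero, Implementation.init] at hb
  | succ t ih =>
    by_cases hp : ∀ e, L[t]? = some e → e.proc ≠ p
    · rw [(h.loc_succ_of_ne hp).2] at hb
      obtain ⟨s, op, h1, h2, h3⟩ := ih hb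
      refine ⟨s, op, by omega, h2, fun u hu hut res hc => ?_⟩
      rcases Nat.lt_succ_iff_lt_or_eq.1 hut with h4 | rfl
      · exact h3 u hu h4 res hc
      · exact hp _ hc rfl
    · push Not at hp
      obtain ⟨e, he, hep⟩ := hp
      have hstep := h.step he
      by_cases hres : ∃ res, e = .respond p res
      · obtain ⟨res, rfl⟩ := hres
        generalize C (t + 1) = D at hstep hb
        generalize C t = D₀ at hstep
        cases hstep
        simp at hb
      · by_cases hinv : ∃ op, e = .invoke p op
        · obtain ⟨op, rfl⟩ := hinv
          exact ⟨t, op, t.lt_succ_self, he, fun u h1 h2 => by omega⟩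
        · have hb' : (C t).busy p = true := by
            generalize C (t + 1) = D at hstep hb
            generalize C t = D₀ at hstep
            cases hstep <;> simp_all [Event.proc]
          obtain ⟨s, op, h1, h2, h3⟩ := ih hb'
          refine ⟨s, op, by omega, h2, fun u hu hut res hc => ?_⟩
          rcases Nat.lt_succ_iff_lt_or_eq.1 hut with h4 | rfl
          · exact h3 u hu h4 res hc
          · rw [he] at hc
            exact hres ⟨res, Option.some.inj hc⟩

theorem not_invoke_of_inCall (h : IsRun I L C) {s t : ℕ} {p : Proc} {op op' : Op T}
    (hc : InCall L s t p op) : L[t]? ≠ some (.invoke p op') := by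
  intro he
  have hb := h.busy_of_inCall hc
  have hs := h.step he
  generalize C (t + 1) = D at hs
  generalize C t = D₀ at hs hb
  cases hs
  simp_all

/-- Induction over the steps of a pending call. -/
theorem inCall_induction (h : IsRun I L C) {s : ℕ} {p : Proc} {op : Op T} {Q : ℕ → State → Prop}
    (hinv : Q (s + 1) (I.invoke op ((C s).loc p)))
    (hframe : ∀ t st, s < t → (∀ e, L[t]? = some e → e.proc ≠ p) → Q t st → Q (t + 1) st)
    (hread : ∀ t r cont, InCall L s t p op → L[t]? = some (.read p r ((C t).mem r)) →
      I.next ((C t).loc p) = .read r cont → Q t ((C t).loc p) → Q (t + 1) (cont ((C t).mem r)))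
    (hwrite : ∀ t r v cont, InCall L s t p op → L[t]? = some (.write p r v) →
      I.next ((C t).loc p) = .write r v cont → Q t ((C t).loc p) → Q (t + 1) cont)
    {t : ℕ} (hc : InCall L s t p op) : Q t ((C t).loc p) := by
  obtain ⟨hst, hs, hr⟩ := hc
  induction t, hst using Nat.le_induction with
  | base =>
    have hs := h.step hs
    revert hinv
    generalize C (s + 1) = D at hs ⊢
    generalize C s = D₀ at hs ⊢
    intro hinv
    cases hs
    simpa using hinv
  | succ t hst ih =>
    have hr' : ∀ u, s < u → u < t → ∀ res, L[u]? ≠ some (.respond p res) :=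
      fun u h1 h2 => hr u h1 (h2.trans t.lt_succ_self)
    have ih := ih hr'
    by_cases hp : ∀ e, L[t]? = some e → e.proc ≠ p
    · rw [(h.loc_succ_of_ne hp).1]
      exact hframe t _ hst hp ih
    · push Not at hp
      obtain ⟨e, he, hep⟩ := hp
      have hcall : InCall L s t p op := ⟨hst, hs, hr'⟩
      have hstep := h.step he
      have hread := hread t
      have hwrite := hwrite t
      cases e with
      | invoke q op' =>
        obtain rfl : q = p := hep
        exact absurd he (h.not_invoke_of_inCall hcall)
      | respond q res =>
        obtain rfl : q = p := hep
        exact absurd he (hr t (by omega) t.lt_succ_self res)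
      | read q r v =>
        obtain rfl : q = p := hep
        generalize C (t + 1) = D at hstep ⊢
        generalize C t = D₀ at *
        cases hstep with
        | read _ _ cont hb hn => simpa using hread r cont hcall he hn ih
      | write q r v =>
        obtain rfl : q = p := hep
        generalize C (t + 1) = D at hstep ⊢
        generalize C t = D₀ at *
        cases hstep with
        | write _ _ _ cont hb hn => simpa using hwrite r v cont hcall he hn ih

end IsRun

end Runs

/-! ### What a pending call has seen and done at each program point -/

section CallInvariant

variable {Proc : Type*}

/-- A call of `getTS` by `p` that was invoked at time `s` and left the loop of lines 1-3 by a read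
at time `τ` has local variables `r` and `myrnd = ψ` and is about to begin iteration `j` of the
for-loop at time `κ`. -/
structure Loop (L : List (Event Proc ℕ (Content Proc) (ℕ × ℕ)))
    (C : ℕ → Config Proc ℕ (Content Proc) (Local Proc)) (p : Proc) (s τ κ : ℕ) (r : View Proc)
    (ψ j : ℕ) : Prop where
  start_lt : s < τ
  exit_lt : τ < κ
  exit_read : (C τ).mem (ψ + 1) = none
  reads : ∀ i, 1 ≤ i → i ≤ ψ → ∃ u, s < u ∧ u < τ ∧ (C u).mem i = r i ∧ r i ≠ none
  -- An iteration is survived only if the test of `line7` failed, at time `a`, and the round was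
  -- then found (`line10`) or made (`line11`) at least `ψ`, at time `b`.
  progress : ∀ i, 1 ≤ i → i < j → ∃ a b, τ < a ∧ a < b ∧ b ≤ κ ∧
    entry (r ψ) i ≠ lastOf ((C a).mem i) ∧ ψ ≤ rndOf ((C b).mem i)
  history : ∀ u, s ≤ u → u < κ → ∀ i v, L[u]? = some (.write p i v) →
    (∃ r, ((C u).loc p).pc = .line11 r ψ i) ∧ i < j

/-- What is known about a call of `getTS` by `p`, invoked at time `s` and pending at time `t`, at
each point of its program. -/
def CallInv (m : ℕ) (L : List (Event Proc ℕ (Content Proc) (ℕ × ℕ)))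
    (C : ℕ → Config Proc ℕ (Content Proc) (Local Proc)) (p : Proc) (s t : ℕ) : PC Proc → Prop
  | .idle => False
  | .line1 r j => 1 ≤ j ∧ Quiet L p s t ∧
      ∀ i, 1 ≤ i → i < j → ∃ u, s < u ∧ u < t ∧ (C u).mem i = r i ∧ r i ≠ none
  | .line2 r j => 1 ≤ j ∧ Quiet L p s t ∧ (∃ u, s < u ∧ u < t ∧ (C u).mem j ≠ none) ∧
      ∀ i, 1 ≤ i → i < j → ∃ u, s < u ∧ u < t ∧ (C u).mem i = r i ∧ r i ≠ none
  | .line6 r ψ j => 1 ≤ j ∧ j < ψ ∧ ∃ τ κ, Loop L C p s τ κ r ψ j ∧ Quiet L p κ t ∧ κ ≤ t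
  | .line7 r ψ j => 1 ≤ j ∧ j < ψ ∧ ∃ τ κ a, Loop L C p s τ κ r ψ j ∧ Quiet L p κ t ∧
      κ ≤ a ∧ a < t ∧ (C a).mem (ψ + 1) = none
  | .line8 ψ j => 1 ≤ j ∧ j < ψ ∧ ∃ r τ κ a b, Loop L C p s τ κ r ψ j ∧ Quiet L p κ t ∧
      κ ≤ a ∧ a < b ∧ b < t ∧ (C a).mem (ψ + 1) = none ∧ entry (r ψ) j = lastOf ((C b).mem j)
  | .line10 r ψ j => 1 ≤ j ∧ j < ψ ∧ ∃ τ κ a b, Loop L C p s τ κ r ψ j ∧ Quiet L p κ t ∧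
      κ ≤ a ∧ a < b ∧ b < t ∧ (C a).mem (ψ + 1) = none ∧ entry (r ψ) j ≠ lastOf ((C b).mem j)
  | .line11 r ψ j => 1 ≤ j ∧ j < ψ ∧ ∃ τ κ a b c, Loop L C p s τ κ r ψ j ∧ Quiet L p κ t ∧
      κ ≤ a ∧ a < b ∧ b < c ∧ c < t ∧ (C a).mem (ψ + 1) = none ∧
      entry (r ψ) j ≠ lastOf ((C b).mem j) ∧ rndOf ((C c).mem j) < ψ
  -- The current collect starts at time `μ`, and the previous one lies in `[κ, μ)`. The guard `0 <
  -- m` is there because for `m = 0` the scan would still read `R[1]`. In the last clause, `cur`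
  -- starts as `⊥` everywhere, so a nonempty entry must have been read.
  | .line13 ψ prev cur j => 1 ≤ j ∧ (0 < m → j ≤ m) ∧ ∃ r τ κ μ k, Loop L C p s τ κ r ψ k ∧
      Quiet L p κ t ∧ ψ ≤ k ∧ k ≤ ψ + 1 ∧ κ ≤ μ ∧ μ ≤ t ∧
      (∀ old ∈ prev, ∀ i, 1 ≤ i → i ≤ m → ∃ u, κ ≤ u ∧ u < μ ∧ (C u).mem i = old i) ∧
      (∀ i, 1 ≤ i → i < j → ∃ u, μ ≤ u ∧ u < t ∧ (C u).mem i = cur i) ∧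
      (∀ i, cur i ≠ none → ∃ u, μ ≤ u ∧ u < t ∧ (C u).mem i = cur i)
  | .line15 view ψ => ∃ r τ κ μ k, Loop L C p s τ κ r ψ k ∧
      Quiet L p κ t ∧ ψ ≤ k ∧ k ≤ ψ + 1 ∧ κ ≤ μ ∧ μ ≤ t ∧ view (ψ + 1) = none ∧
      ∀ i, 1 ≤ i → i ≤ m → ∃ u u', κ ≤ u ∧ u < μ ∧ μ ≤ u' ∧ u' < t ∧
        (C u).mem i = view i ∧ (C u').mem i = view i
  | .retTS x =>
      -- The three ways to return `(ψ + 1, 0)` are merged: ordering timestamps only needs that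
      -- `R[ψ+1]` was empty during the call and filled by its end.
      (∃ ψ τ u, x = (ψ + 1, 0) ∧ s < τ ∧ τ < t ∧ (C τ).mem (ψ + 1) = none ∧
        u ≤ t ∧ (C u).mem (ψ + 1) ≠ none) ∨
      (∃ ψ j r τ κ b c, x = (ψ, j) ∧ 1 ≤ j ∧ j < ψ ∧ Loop L C p s τ κ r ψ j ∧
        κ < b ∧ b < c ∧ c ≤ t ∧ entry (r ψ) j = lastOf ((C b).mem j) ∧ ψ ≤ rndOf ((C c).mem j))
  | .compare _ _ => False

variable {m : ℕ} {L : List (Event Proc ℕ (Content Proc) (ℕ × ℕ))}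
  {C : ℕ → Config Proc ℕ (Content Proc) (Local Proc)} {p : Proc} {s t : ℕ}

theorem CallInv.frame {pc : PC Proc} (h : CallInv m L C p s t pc)
    (hw : ∀ i v, L[t]? ≠ some (.write p i v)) : CallInv m L C p s (t + 1) pc := by
  cases pc with
  | idle => exact h
  | compare => exact h
  | line1 r j =>
    obtain ⟨h1, h2, h3⟩ := h
    refine ⟨h1, h2.succ hw, fun i hi hij => ?_⟩
    obtain ⟨u, h4, h5, h6⟩ := h3 i hi hij
    exact ⟨u, h4, by omega, h6⟩
  | line2 r j =>
    obtain ⟨h1, h2, ⟨u, h4, h5, h6⟩, h3⟩ := h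
    refine ⟨h1, h2.succ hw, ⟨u, h4, by omega, h6⟩, fun i hi hij => ?_⟩
    obtain ⟨u, h4, h5, h6⟩ := h3 i hi hij
    exact ⟨u, h4, by omega, h6⟩
  | line6 r ψ j =>
    obtain ⟨h1, h2, τ, κ, h3, h4, h5⟩ := h
    exact ⟨h1, h2, τ, κ, h3, h4.succ hw, by omega⟩
  | line7 r ψ j =>
    obtain ⟨h1, h2, τ, κ, a, h3, h4, h5, h6, h7⟩ := h
    exact ⟨h1, h2, τ, κ, a, h3, h4.succ hw, h5, by omega, h7⟩
  | line8 ψ j =>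
    obtain ⟨h1, h2, r, τ, κ, a, b, h3, h4, h5, h6, h7, h8⟩ := h
    exact ⟨h1, h2, r, τ, κ, a, b, h3, h4.succ hw, h5, h6, by omega, h8⟩
  | line10 r ψ j =>
    obtain ⟨h1, h2, τ, κ, a, b, h3, h4, h5, h6, h7, h8⟩ := h
    exact ⟨h1, h2, τ, κ, a, b, h3, h4.succ hw, h5, h6, by omega, h8⟩
  | line11 r ψ j =>
    obtain ⟨h1, h2, τ, κ, a, b, c, h3, h4, h5, h6, h7, h8, h9⟩ := h
    exact ⟨h1, h2, τ, κ, a, b, c, h3, h4.succ hw, h5, h6, h7, by omega, h9⟩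
  | line13 ψ prev cur j =>
    obtain ⟨h1, h2, r, τ, κ, μ, k, h3, h4, h5, h6, h7, h8, h9, h10, h11⟩ := h
    refine ⟨h1, h2, r, τ, κ, μ, k, h3, h4.succ hw, h5, h6, h7, by omega, h9, fun i hi hij => ?_,
      fun i hi => ?_⟩
    · obtain ⟨u, h12, h13, h14⟩ := h10 i hi hij
      exact ⟨u, h12, by omega, h14⟩
    · obtain ⟨u, h12, h13, h14⟩ := h11 i hi
      exact ⟨u, h12, by omega, h14⟩
  | line15 view ψ =>
    obtain ⟨r, τ, κ, μ, k, h3, h4, h5, h6, h7, h8, h9, h10⟩ := h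
    refine ⟨r, τ, κ, μ, k, h3, h4.succ hw, h5, h6, h7, by omega, h9, fun i hi hij => ?_⟩
    obtain ⟨u, u', h12, h13, h14, h15, h16⟩ := h10 i hi hij
    exact ⟨u, u', h12, h13, h14, by omega, h16⟩
  | retTS x =>
    rcases h with ⟨ψ, τ, u, h1, h2, h3, h4, h5, h6⟩ |
      ⟨ψ, j, r, τ, κ, b, c, h1, h2, h3, h4, h5, h6, h7, h8⟩
    · exact .inl ⟨ψ, τ, u, h1, h2, by omega, h4, by omega, h6⟩
    · exact .inr ⟨ψ, j, r, τ, κ, b, c, h1, h2, h3, h4, h5, h6, by omega, h8⟩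

theorem Loop.callInv_forLoop {τ : ℕ} {r : View Proc} {ψ j : ℕ} (h : Loop L C p s τ t r ψ j)
    (hj : 1 ≤ j) (hψ : j ≤ ψ + 1) : CallInv m L C p s t (forLoop r ψ j) := by
  unfold forLoop
  split_ifs with hlt
  · exact ⟨hj, hlt, τ, t, h, Quiet.refl L p t, le_rfl⟩
  · exact ⟨le_rfl, fun h => h, r, τ, t, t, j, h, Quiet.refl L p t, by omega, hψ, le_rfl, le_rfl,
      by simp, fun i h1 h2 => by omega, fun i hi => absurd rfl hi⟩

variable [DecidableEq Proc]

namespace IsRun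

theorem write_ne_none (h : IsRun (algorithm Proc m) L C) {t i : ℕ} {p : Proc}
    {v : Content Proc} (hw : L[t]? = some (.write p i v)) : v ≠ none := by
  have hs := h.step hw
  generalize C (t + 1) = D at hs
  generalize C t = D₀ at hs
  cases hs with
  | write _ _ _ cont hb hn =>
    unfold algorithm at hn
    dsimp only at hn
    split at hn <;> simp at hn
    all_goals
      obtain ⟨-, rfl, -⟩ := hn
      simp

theorem mem_mono (h : IsRun (algorithm Proc m) L C) {t t' i : ℕ} (hm : (C t).mem i ≠ none)
    (ht : t ≤ t') : (C t').mem i ≠ none := by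
  induction t', ht using Nat.le_induction with
  | base => exact hm
  | succ t' ht ih =>
    by_cases hw : WriteTo L t' i
    · obtain ⟨p, v, hv⟩ := hw
      rw [h.mem_succ_of_write hv]
      exact h.write_ne_none hv
    · rwa [h.mem_succ_of_not_writeTo hw]

theorem mem_none_of_le (h : IsRun (algorithm Proc m) L C) {t t' i : ℕ}
    (hm : (C t').mem i = none) (ht : t ≤ t') : (C t).mem i = none := by
  by_contra hc
  exact h.mem_mono hc ht hm

theorem pc_of_inCall_compare (h : IsRun (algorithm Proc m) L C) {t₁ t₂ : ℕ × ℕ}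
    (hc : InCall L s t p (.compare t₁ t₂)) : ((C t).loc p).pc = .compare t₁ t₂ := by
  refine h.inCall_induction (Q := fun _ st => st.pc = .compare t₁ t₂) ?_ ?_ ?_ ?_ hc
  · simp [algorithm]
  · exact fun _ _ _ _ h => h
  · intro t r cont _ _ hn hpc
    simp [algorithm, hpc] at hn
  · intro t r v cont _ _ hn hpc
    simp [algorithm, hpc] at hn

theorem callInv_step_read (h : IsRun (algorithm Proc m) L C) {i : ℕ}
    {cont : Content Proc → Local Proc} (hst : s < t)
    (he : L[t]? = some (.read p i ((C t).mem i)))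
    (hn : (algorithm Proc m).next ((C t).loc p) = .read i cont)
    (hI : CallInv m L C p s t ((C t).loc p).pc) :
    CallInv m L C p s (t + 1) (cont ((C t).mem i)).pc := by
  have hw : ∀ i v, L[t]? ≠ some (.write p i v) := by simp [he]
  cases hpc : ((C t).loc p).pc with
  | idle => simp [algorithm, hpc] at hn
  | compare => simp [algorithm, hpc] at hn
  | retTS => simp [algorithm, hpc] at hn
  | line8 => simp [algorithm, hpc] at hn
  | line11 => simp [algorithm, hpc] at hn
  | line15 => simp [algorithm, hpc] at hn
  | line1 r j =>
    simp [algorithm, hpc] at hn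
    obtain ⟨rfl, rfl⟩ := hn
    rw [hpc] at hI
    obtain ⟨h1, h2, h3⟩ := hI
    dsimp only
    split_ifs with hv
    · refine Loop.callInv_forLoop (τ := t) ⟨hst, t.lt_succ_self, ?_, ?_, ?_, ?_⟩ le_rfl (by omega)
      · rwa [show j - 1 + 1 = j by omega]
      · exact fun i hi hij => h3 i hi (by omega)
      · intro i hi hi'
        omega
      · intro u hu hu' i v hw'
        exact absurd hw' (h2.succ hw u hu hu' i v)
    · refine ⟨h1, h2.succ hw, ⟨t, hst, t.lt_succ_self, hv⟩, fun i hi hij => ?_⟩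
      obtain ⟨u, h4, h5, h6⟩ := h3 i hi hij
      exact ⟨u, h4, by omega, h6⟩
  | line2 r j =>
    simp [algorithm, hpc] at hn
    obtain ⟨rfl, rfl⟩ := hn
    rw [hpc] at hI
    obtain ⟨h1, h2, ⟨u, h4, h5, h6⟩, h3⟩ := hI
    refine ⟨by omega, h2.succ hw, fun i hi hij => ?_⟩
    by_cases hij' : i = j
    -- The value stored is that of the second read of `R[j]`, which is still nonempty by
    -- monotonicity.
    · subst hij'
      exact ⟨t, hst, t.lt_succ_self, by simp, by simpa using h.mem_mono h6 h5.le⟩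
    · obtain ⟨u, h4, h5, h6⟩ := h3 i hi (by omega)
      exact ⟨u, h4, by omega, by simpa [hij'] using h6⟩
  | line6 r ψ j =>
    simp [algorithm, hpc] at hn
    obtain ⟨rfl, rfl⟩ := hn
    rw [hpc] at hI
    obtain ⟨h1, h2, τ, κ, h3, h4, h5⟩ := hI
    dsimp only
    split_ifs with hv
    · exact ⟨h1, h2, τ, κ, t, h3, h4.succ hw, h5, t.lt_succ_self, hv⟩
    · have := h3.exit_lt
      exact .inl ⟨ψ, τ, t, rfl, h3.start_lt, by omega, h3.exit_read, by omega, hv⟩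
  | line7 r ψ j =>
    simp [algorithm, hpc] at hn
    obtain ⟨rfl, rfl⟩ := hn
    rw [hpc] at hI
    obtain ⟨h1, h2, τ, κ, a, h3, h4, h5, h6, h7⟩ := hI
    dsimp only
    split_ifs with hv
    · exact ⟨h1, h2, r, τ, κ, a, t, h3, h4.succ hw, h5, h6, t.lt_succ_self, h7, hv⟩
    · exact ⟨h1, h2, τ, κ, a, t, h3, h4.succ hw, h5, h6, t.lt_succ_self, h7, hv⟩
  | line10 r ψ j =>
    simp [algorithm, hpc] at hn
    obtain ⟨rfl, rfl⟩ := hn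
    rw [hpc] at hI
    obtain ⟨h1, h2, τ, κ, a, b, h3, h4, h5, h6, h7, h8, h9⟩ := hI
    dsimp only
    split_ifs with hv
    · exact ⟨h1, h2, τ, κ, a, b, t, h3, h4.succ hw, h5, h6, h7, t.lt_succ_self, h8, h9, hv⟩
    · have hτ := h3.exit_lt
      refine Loop.callInv_forLoop (τ := τ) ⟨h3.start_lt, by omega, h3.exit_read, h3.reads,
        ?_, ?_⟩ (by omega) (by omega)
      · intro i hi hij
        by_cases hij' : i = j
        · subst hij'
          exact ⟨b, t, by omega, h7, by omega, h9, by omega⟩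
        · obtain ⟨a', b', h10, h11, h12, h13⟩ := h3.progress i hi (by omega)
          exact ⟨a', b', h10, h11, by omega, h13⟩
      · intro u hu hu' i v hw'
        obtain ⟨h10, h11⟩ := h3.history u hu ((h4.succ hw).lt_of_write hu' hw') i v hw'
        exact ⟨h10, by omega⟩
  | line13 ψ prev cur j =>
    simp [algorithm, hpc] at hn
    obtain ⟨rfl, rfl⟩ := hn
    rw [hpc] at hI
    obtain ⟨h1, h2, r, τ, κ, μ, k, h3, h4, h5, h6, h7, h8, h9, h10, h11⟩ := hI
    have hτ := h3.exit_lt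
    set view := Function.update cur j ((C t).mem j) with hview
    have hcur : ∀ i, 1 ≤ i → i < j + 1 → ∃ u, μ ≤ u ∧ u < t + 1 ∧ (C u).mem i = view i := by
      intro i hi hij
      by_cases hij' : i = j
      · subst hij'
        exact ⟨t, h8, t.lt_succ_self, by simp [hview]⟩
      · obtain ⟨u, h12, h13, h14⟩ := h10 i hi (by omega)
        exact ⟨u, h12, by omega, by simpa [hview, hij'] using h14⟩
    have hne : ∀ i, view i ≠ none → ∃ u, μ ≤ u ∧ u < t + 1 ∧ (C u).mem i = view i := by
      intro i hi
      by_cases hij' : i = j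
      · subst hij'
        exact ⟨t, h8, t.lt_succ_self, by simp [hview]⟩
      · obtain ⟨u, h12, h13, h14⟩ := h11 i (by simpa [hview, hij'] using hi)
        exact ⟨u, h12, by omega, by simpa [hview, hij'] using h14⟩
    simp only [afterScanRead]
    rw [← hview]
    split_ifs with hj hold hnone
    · exact ⟨by omega, fun _ => hj, r, τ, κ, μ, k, h3, h4.succ hw, h5, h6, h7, by omega, h9, hcur,
        hne⟩
    · obtain ⟨old, hmem, heq⟩ := hold
      refine ⟨r, τ, κ, μ, k, h3, h4.succ hw, h5, h6, h7, by omega, hnone, fun i hi him => ?_⟩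
      obtain ⟨u, h12, h13, h14⟩ := h9 old hmem i hi him
      obtain ⟨u', h15, h16, h17⟩ := hcur i hi (by omega)
      exact ⟨u, u', h12, h13, h15, h16, by rw [h14, heq i (Finset.mem_Icc.2 ⟨hi, him⟩)], h17⟩
    · obtain ⟨u, h12, h13, h14⟩ := hne _ hnone
      exact .inl ⟨ψ, τ, u, rfl, h3.start_lt, by omega, h3.exit_read, by omega, by rwa [h14]⟩
    · refine ⟨le_rfl, fun h => h, r, τ, κ, t + 1, k, h3, h4.succ hw, h5, h6, by omega, le_rfl, ?_,
        fun i hi hi' => by omega, fun i hi => absurd rfl hi⟩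
      intro old hold' i hi him
      obtain rfl : view = old := by simpa using hold'
      obtain ⟨u, h12, h13, h14⟩ := hcur i hi (by omega)
      exact ⟨u, by omega, h13, h14⟩

theorem callInv_step_write (h : IsRun (algorithm Proc m) L C) {i : ℕ} {v : Content Proc}
    {cont : Local Proc} (he : L[t]? = some (.write p i v))
    (hn : (algorithm Proc m).next ((C t).loc p) = .write i v cont)
    (hI : CallInv m L C p s t ((C t).loc p).pc) : CallInv m L C p s (t + 1) cont.pc := by
  have hmem := h.mem_succ_of_write he
  cases hpc : ((C t).loc p).pc with
  | idle => simp [algorithm, hpc] at hn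
  | compare => simp [algorithm, hpc] at hn
  | retTS => simp [algorithm, hpc] at hn
  | line1 => simp [algorithm, hpc] at hn
  | line2 => simp [algorithm, hpc] at hn
  | line6 => simp [algorithm, hpc] at hn
  | line7 => simp [algorithm, hpc] at hn
  | line10 => simp [algorithm, hpc] at hn
  | line13 => simp [algorithm, hpc] at hn
  | line8 ψ j =>
    simp [algorithm, hpc] at hn
    obtain ⟨rfl, rfl, rfl⟩ := hn
    rw [hpc] at hI
    obtain ⟨h1, h2, r, τ, κ, a, b, h3, h4, h5, h6, h7, h8, h9⟩ := hI
    exact .inr ⟨ψ, j, r, τ, κ, b, t + 1, rfl, h1, h2, h3, by omega, by omega, le_rfl, h9,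
      by simp [hmem, rndOf]⟩
  | line11 r ψ j =>
    simp [algorithm, hpc] at hn
    obtain ⟨rfl, rfl, rfl⟩ := hn
    rw [hpc] at hI
    obtain ⟨h1, h2, τ, κ, a, b, c, h3, h4, h5, h6, h7, h8, h9, h10, h11⟩ := hI
    have hτ := h3.exit_lt
    refine Loop.callInv_forLoop (τ := τ) ⟨h3.start_lt, by omega, h3.exit_read, h3.reads,
      ?_, ?_⟩ (by omega) (by omega)
    · intro i hi hij
      by_cases hij' : i = j
      · subst hij'
        exact ⟨b, t + 1, by omega, by omega, by omega, h10, by simp [hmem, rndOf]⟩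
      · obtain ⟨a', b', h12, h13, h14, h15⟩ := h3.progress i hi (by omega)
        exact ⟨a', b', h12, h13, by omega, h15⟩
    · intro u hu hu' i v hw'
      rcases Nat.lt_succ_iff_lt_or_eq.1 hu' with hu'' | rfl
      · obtain ⟨h12, h13⟩ := h3.history u hu (h4.lt_of_write hu'' hw') i v hw'
        exact ⟨h12, by omega⟩
      · rw [he] at hw'
        simp at hw'
        obtain ⟨rfl, rfl⟩ := hw'
        exact ⟨⟨r, hpc⟩, by omega⟩
  | line15 view ψ =>
    simp [algorithm, hpc] at hn
    obtain ⟨rfl, rfl, rfl⟩ := hn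
    rw [hpc] at hI
    obtain ⟨r, τ, κ, μ, k, h3, h4, h5, h6, h7, h8, h9, h10⟩ := hI
    have hτ := h3.exit_lt
    exact .inl ⟨ψ, τ, t + 1, rfl, h3.start_lt, by omega, h3.exit_read, le_rfl, by simp [hmem]⟩

theorem callInv (h : IsRun (algorithm Proc m) L C) (hc : InCall L s t p .getTS) :
    CallInv m L C p s t ((C t).loc p).pc := by
  refine h.inCall_induction (Q := fun t st => CallInv m L C p s t st.pc) ?_ ?_ ?_ ?_ hc
  · refine ⟨le_rfl, (Quiet.refl L p s).succ ?_, fun i hi hi' => by omega⟩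
    simp [hc.2.1]
  · exact fun t st _ hp hQ => hQ.frame fun i v hv => hp _ hv rfl
  · exact fun t r cont hc he hn hQ => h.callInv_step_read hc.1 he hn hQ
  · exact fun t r v cont hc he hn hQ => h.callInv_step_write he hn hQ

end IsRun

end CallInvariant

/-! ### Writes: initial segments, rounds, identifiers, absence of ABA -/

section Writes

variable {Proc : Type*}

/-- The local variable `myrnd`, at the points of the program right before a write. -/
def PC.myrnd : PC Proc → ℕ
  | .line8 ψ _ => ψ
  | .line11 _ ψ _ => ψ
  | .line15 _ ψ => ψ
  | _ => 0

/-- `filterMap` drops missing identifiers, so positions match register indices only because none is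
missing. -/
theorem getElem?_lasts {r : View Proc} {k i : ℕ} (hr : ∀ i < k, lastOf (r (i + 1)) ≠ none)
    (hi : i < k) : (lasts r k)[i]? = lastOf (r (i + 1)) ∧ (lasts r k).length = k := by
  induction k generalizing i with
  | zero => omega
  | succ k ih =>
    have hlen : (lasts r k).length = k := by
      rcases k with _ | k
      · simp [lasts]
      · exact (ih (i := 0) (fun i hi => hr i (by omega)) (by omega)).2
    obtain ⟨x, hx⟩ := Option.ne_none_iff_exists'.1 (hr k k.lt_succ_self)
    have hsucc : lasts r (k + 1) = lasts r k ++ [x] := by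
      simp [lasts, List.range_succ, hx]
    rw [hsucc]
    refine ⟨?_, by simp [hlen]⟩
    rcases Nat.lt_succ_iff_lt_or_eq.1 hi with h | rfl
    · rw [List.getElem?_append_left (by omega)]
      exact (ih (fun i hi => hr i (by omega)) h).1
    · simp [hlen, hx]

variable [DecidableEq Proc] {m : ℕ} {L : List (Event Proc ℕ (Content Proc) (ℕ × ℕ))}
  {C : ℕ → Config Proc ℕ (Content Proc) (Local Proc)} {p : Proc} {s t w i : ℕ} {v : Content Proc}

namespace IsRun

theorem exists_inCall_getTS_of_write (h : IsRun (algorithm Proc m) L C)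
    (hw : L[w]? = some (.write p i v)) : ∃ s, InCall L s w p .getTS := by
  have hs := h.step hw
  have hbn : (C w).busy p = true ∧
      ∃ cont, (algorithm Proc m).next ((C w).loc p) = .write i v cont := by
    generalize C (w + 1) = D at hs
    generalize C w = D₀ at hs
    cases hs with
    | write _ _ _ cont hb hn => exact ⟨hb, cont, hn⟩
  obtain ⟨hb, cont, hn⟩ := hbn
  obtain ⟨s, op, hc⟩ := h.exists_inCall hb
  cases op with
  | getTS => exact ⟨s, hc⟩
  | compare t₁ t₂ => simp [algorithm, h.pc_of_inCall_compare hc] at hn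

/-- The three writes of the program. -/
theorem pc_of_write (h : IsRun (algorithm Proc m) L C) (hw : L[w]? = some (.write p i v)) :
    (∃ ψ, ((C w).loc p).pc = .line8 ψ i ∧ v = some ([((C w).loc p).id], ψ)) ∨
    (∃ r ψ, ((C w).loc p).pc = .line11 r ψ i ∧ v = some ([((C w).loc p).id], ψ)) ∨
    (∃ r ψ, i = ψ + 1 ∧ ((C w).loc p).pc = .line15 r ψ ∧
      v = some (lasts r ψ ++ [((C w).loc p).id], ψ + 1)) := by
  have hs := h.step hw
  generalize C (w + 1) = D at hs
  generalize C w = D₀ at hs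
  cases hs with
  | write _ _ _ cont hb hn =>
    unfold algorithm at hn
    dsimp only at hn
    split at hn <;> simp at hn
    · obtain ⟨rfl, rfl, -⟩ := hn
      exact .inl ⟨_, by assumption, rfl⟩
    · obtain ⟨rfl, rfl, -⟩ := hn
      exact .inr (.inl ⟨_, _, by assumption, rfl⟩)
    · obtain ⟨rfl, rfl, -⟩ := hn
      exact .inr (.inr ⟨_, _, rfl, by assumption, rfl⟩)

theorem lastOf_of_write (h : IsRun (algorithm Proc m) L C) (hw : L[w]? = some (.write p i v)) :
    lastOf v = some ((C w).loc p).id := by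
  rcases h.pc_of_write hw with ⟨ψ, -, rfl⟩ | ⟨r, ψ, -, rfl⟩ | ⟨r, ψ, -, -, rfl⟩ <;> simp [lastOf]

/-- Collects what the three kinds of writes have in common. The emptiness of `R[myrnd + 1]` was read
at `line6` before an invalidation, but in the scan before `line15`; the scan covers only `R[1..m]`,
whence the guard in the last clause. -/
theorem loop_of_write (h : IsRun (algorithm Proc m) L C) (hw : L[w]? = some (.write p i v))
    (hc : InCall L s w p .getTS) :
    ∃ τ κ r k, Loop L C p s τ κ r ((C w).loc p).pc.myrnd k ∧ Quiet L p κ w ∧ κ ≤ w ∧ 1 ≤ i ∧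
      k ≤ i ∧ i ≤ ((C w).loc p).pc.myrnd + 1 ∧
      (((C w).loc p).pc.myrnd + 1 ≤ m ∨ i ≤ ((C w).loc p).pc.myrnd →
        ∃ a, κ ≤ a ∧ a < w ∧ (C a).mem (((C w).loc p).pc.myrnd + 1) = none) := by
  have hI := h.callInv hc
  rcases h.pc_of_write hw with ⟨ψ, hpc, -⟩ | ⟨r, ψ, hpc, -⟩ | ⟨r, ψ, rfl, hpc, -⟩
  · rw [hpc] at hI ⊢
    obtain ⟨h1, h2, r, τ, κ, a, b, h3, h4, h5, h6, h7, h8, h9⟩ := hI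
    exact ⟨τ, κ, r, i, h3, h4, by omega, h1, le_rfl, by simp [PC.myrnd]; omega,
      fun _ => ⟨a, h5, by omega, h8⟩⟩
  · rw [hpc] at hI ⊢
    obtain ⟨h1, h2, τ, κ, a, b, c, h3, h4, h5, h6, h7, h8, h9, h10, h11⟩ := hI
    exact ⟨τ, κ, r, i, h3, h4, by omega, h1, le_rfl, by simp [PC.myrnd]; omega,
      fun _ => ⟨a, h5, by omega, h9⟩⟩
  · rw [hpc] at hI ⊢
    obtain ⟨r', τ, κ, μ, k, h3, h4, h5, h6, h7, h8, h9, h10⟩ := hI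
    refine ⟨τ, κ, r', k, h3, h4, by omega, by omega, h6, le_rfl, fun hm => ?_⟩
    obtain ⟨u, u', h11, h12, h13, h14, h15, h16⟩ := h10 (ψ + 1) (by omega)
      (by simpa [PC.myrnd] using hm)
    exact ⟨u, h11, by omega, by simpa [PC.myrnd, h15] using h9⟩

theorem mem_ne_none_of_loop (h : IsRun (algorithm Proc m) L C) {τ κ ψ k : ℕ} {r : View Proc}
    (hl : Loop L C p s τ κ r ψ k) (hi : 1 ≤ i) (hiψ : i ≤ ψ) (ht : τ ≤ t) :
    (C t).mem i ≠ none := by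
  obtain ⟨u, -, h2, h3, h4⟩ := hl.reads i hi hiψ
  exact h.mem_mono (h3 ▸ h4) (by omega)

theorem exists_write_of_mem_ne_none (h : IsRun (algorithm Proc m) L C)
    (hm : (C t).mem i ≠ none) : ∃ w p, w < t ∧ L[w]? = some (.write p i ((C t).mem i)) ∧
      ∀ u, w < u → u < t → ¬ WriteTo L u i := by
  obtain ⟨w, p, -, h1, h2⟩ := h.exists_last_write_of_ne (a := 0) (b := t) (j := i) t.zero_le
    (by rw [h.zero]; exact hm.symm)
  exact ⟨w, p, h1, h2⟩

/-- A process that writes `R[j]` has `j ≤ myrnd + 1` and has read `R[1..myrnd]` as nonempty, and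
registers never become empty again. -/
theorem mem_ne_none_of_le (h : IsRun (algorithm Proc m) L C) {j : ℕ} (hm : (C t).mem j ≠ none)
    (hi : 1 ≤ i) (hij : i ≤ j) : (C t).mem i ≠ none := by
  rcases hij.eq_or_lt with rfl | hij
  · exact hm
  obtain ⟨w, p, hwt, hw, -⟩ := h.exists_write_of_mem_ne_none hm
  obtain ⟨s, hc⟩ := h.exists_inCall_getTS_of_write hw
  obtain ⟨τ, κ, r, k, hl, -, h1, h2, h3, h4, -⟩ := h.loop_of_write hw hc
  have := hl.exit_lt
  exact h.mem_ne_none_of_loop hl hi (by omega) (by omega)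

theorem one_le_of_mem_ne_none (h : IsRun (algorithm Proc m) L C) (hm : (C t).mem i ≠ none) :
    1 ≤ i := by
  obtain ⟨w, p, hwt, hw, -⟩ := h.exists_write_of_mem_ne_none hm
  obtain ⟨s, hc⟩ := h.exists_inCall_getTS_of_write hw
  obtain ⟨τ, κ, r, k, -, -, -, h2, -⟩ := h.loop_of_write hw hc
  exact h2

theorem lastOf_ne_none (h : IsRun (algorithm Proc m) L C) (hm : (C t).mem i ≠ none) :
    lastOf ((C t).mem i) ≠ none := by
  obtain ⟨w, p, hwt, hw, -⟩ := h.exists_write_of_mem_ne_none hm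
  simp [h.lastOf_of_write hw]

/-- The round of a write is `myrnd` for an invalidation, and the register for a new round. -/
theorem rndOf_of_write (h : IsRun (algorithm Proc m) L C) (hw : L[w]? = some (.write p i v)) :
    i ≤ rndOf v ∧ (rndOf v = i ∨ (C w).mem (rndOf v) ≠ none) := by
  obtain ⟨s, hc⟩ := h.exists_inCall_getTS_of_write hw
  obtain ⟨τ, κ, r, k, hl, -, h1, h2, h3, h4, -⟩ := h.loop_of_write hw hc
  have hI := h.callInv hc
  have := hl.exit_lt
  rcases h.pc_of_write hw with ⟨ψ, hpc, rfl⟩ | ⟨r, ψ, hpc, rfl⟩ | ⟨r, ψ, rfl, hpc, rfl⟩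
  · rw [hpc] at hI hl
    obtain ⟨h1', h2', -⟩ := hI
    exact ⟨h2'.le, .inr (h.mem_ne_none_of_loop hl (by simp [rndOf]; omega) le_rfl (by omega))⟩
  · rw [hpc] at hI hl
    obtain ⟨h1', h2', -⟩ := hI
    exact ⟨h2'.le, .inr (h.mem_ne_none_of_loop hl (by simp [rndOf]; omega) le_rfl (by omega))⟩
  · simp [rndOf]

theorem le_rndOf (h : IsRun (algorithm Proc m) L C) (hm : (C t).mem i ≠ none) :
    i ≤ rndOf ((C t).mem i) ∧ (C t).mem (rndOf ((C t).mem i)) ≠ none := by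
  obtain ⟨w, p, hwt, hw, -⟩ := h.exists_write_of_mem_ne_none hm
  obtain ⟨h1, h2 | h2⟩ := h.rndOf_of_write hw
  · rw [h2]
    exact ⟨le_rfl, hm⟩
  · exact ⟨h1, h.mem_mono h2 hwt.le⟩

/-- A register whose content has a round of at least `ψ ≥ 1` shows that round `ψ` has begun. -/
theorem mem_ne_none_of_le_rndOf (h : IsRun (algorithm Proc m) L C) {ψ : ℕ} (hψ : 1 ≤ ψ)
    (hm : ψ ≤ rndOf ((C t).mem i)) : (C t).mem ψ ≠ none := by
  have hi : (C t).mem i ≠ none := by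
    intro hc
    simp [hc, rndOf] at hm
    omega
  exact h.mem_ne_none_of_le (h.le_rndOf hi).2 hψ hm

theorem name_eq (h : IsRun (algorithm Proc m) L C) : ((C t).loc p).name = p := by
  induction t with
  | zero => simp [h.zero, Implementation.init, algorithm]
  | succ t ih =>
    by_cases hp : ∀ e, L[t]? = some e → e.proc ≠ p
    · rw [(h.loc_succ_of_ne hp).1, ih]
    · push Not at hp
      obtain ⟨e, he, hep⟩ := hp
      have hs := h.step he
      generalize C (t + 1) = D at hs ⊢
      generalize C t = D₀ at hs ih
      cases hs with
      | invoke q op hb =>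
        obtain rfl : q = p := hep
        cases op <;> simpa [algorithm] using ih
      | read q r cont hb hn =>
        obtain rfl : q = p := hep
        unfold algorithm at hn
        dsimp only at hn
        split at hn <;> simp at hn
        all_goals
          obtain ⟨-, rfl⟩ := hn
          simpa using ih
      | write q r v cont hb hn =>
        obtain rfl : q = p := hep
        unfold algorithm at hn
        dsimp only at hn
        split at hn <;> simp at hn
        all_goals
          obtain ⟨-, -, rfl⟩ := hn
          simpa using ih
      | respond q res cont hb hn =>
        obtain rfl : q = p := hep
        unfold algorithm at hn
        dsimp only at hn
        split at hn <;> simp at hn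
        all_goals
          obtain ⟨-, rfl⟩ := hn
          simpa using ih

theorem calls_mono (h : IsRun (algorithm Proc m) L C) {t' : ℕ} (ht : t ≤ t') :
    ((C t).loc p).calls ≤ ((C t').loc p).calls := by
  induction t', ht using Nat.le_induction with
  | base => exact le_rfl
  | succ t' ht ih =>
    refine ih.trans ?_
    by_cases hp : ∀ e, L[t']? = some e → e.proc ≠ p
    · rw [(h.loc_succ_of_ne hp).1]
    · push Not at hp
      obtain ⟨e, he, hep⟩ := hp
      have hs := h.step he
      clear ih
      generalize C (t' + 1) = D at hs ⊢
      generalize C t' = D₀ at hs ⊢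
      cases hs with
      | invoke q op hb =>
        obtain rfl : q = p := hep
        cases op <;> simp [algorithm]
      | read q r cont hb hn =>
        obtain rfl : q = p := hep
        unfold algorithm at hn
        dsimp only at hn
        split at hn <;> simp at hn
        all_goals
          obtain ⟨-, rfl⟩ := hn
          simp
      | write q r v cont hb hn =>
        obtain rfl : q = p := hep
        unfold algorithm at hn
        dsimp only at hn
        split at hn <;> simp at hn
        all_goals
          obtain ⟨-, -, rfl⟩ := hn
          simp
      | respond q res cont hb hn =>
        obtain rfl : q = p := hep
        unfold algorithm at hn
        dsimp only at hn
        split at hn <;> simp at hn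
        all_goals
          obtain ⟨-, rfl⟩ := hn
          simp

theorem calls_of_inCall (h : IsRun (algorithm Proc m) L C) (hc : InCall L s t p .getTS) :
    ((C t).loc p).calls = ((C s).loc p).calls + 1 := by
  refine h.inCall_induction (Q := fun _ st => st.calls = ((C s).loc p).calls + 1) ?_ ?_ ?_ ?_ hc
  · simp [algorithm]
  · exact fun _ _ _ _ h => h
  · intro t r cont _ _ hn hQ
    unfold algorithm at hn
    dsimp only at hn
    split at hn <;> simp at hn
    all_goals
      obtain ⟨-, rfl⟩ := hn
      simpa using hQ
  · intro t r v cont _ _ hn hQ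
    unfold algorithm at hn
    dsimp only at hn
    split at hn <;> simp at hn
    all_goals
      obtain ⟨-, -, rfl⟩ := hn
      simpa using hQ

/-- Identifiers identify calls. -/
theorem inCall_eq_of_id_eq (h : IsRun (algorithm Proc m) L C) {p' : Proc} {s' t' : ℕ}
    (hc : InCall L s t p .getTS) (hc' : InCall L s' t' p' .getTS)
    (hid : ((C t).loc p).id = ((C t').loc p').id) : p = p' ∧ s = s' := by
  simp only [Local.id, h.name_eq, Prod.mk.injEq] at hid
  obtain ⟨rfl, hid⟩ := hid
  refine ⟨rfl, ?_⟩
  rw [h.calls_of_inCall hc, h.calls_of_inCall hc'] at hid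
  -- An invocation of `getTS` raises the counter, which never decreases, so a later invocation by
  -- the same process finds a larger value.
  have key : ∀ {a b x : ℕ}, InCall L a x p .getTS → a < b →
      ((C a).loc p).calls + 1 ≤ ((C b).loc p).calls := by
    intro a b x hca hab
    rw [← h.calls_of_inCall (hca.mono a.lt_succ_self hca.1)]
    exact h.calls_mono hab
  rcases lt_trichotomy s s' with hlt | heq | hlt
  · have := key hc hlt
    omega
  · exact heq
  · have := key hc' hlt
    omega

/-- Earlier writes of the same call are at line 11, with the same `myrnd`, to smaller registers,
and precede the current iteration of the for-loop. -/
theorem history_of_write (h : IsRun (algorithm Proc m) L C) {w' i' : ℕ} {v' : Content Proc}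
    (hc : InCall L s w p .getTS) (hw : L[w]? = some (.write p i v))
    (hc' : InCall L s w' p .getTS) (hw' : L[w']? = some (.write p i' v')) (hlt : w < w') :
    (∃ r, ((C w).loc p).pc = .line11 r ((C w').loc p).pc.myrnd i) ∧ i < i' ∧
      (((C w').loc p).pc.myrnd + 1 ≤ m ∨ i' ≤ ((C w').loc p).pc.myrnd →
        (C w).mem (((C w').loc p).pc.myrnd + 1) = none) := by
  obtain ⟨τ, κ, r, k, hl, hq, h1, h2, h3, h4, h5⟩ := h.loop_of_write hw' hc'
  have hwκ : w < κ := hq.lt_of_write hlt hw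
  obtain ⟨h6, h7⟩ := hl.history w hc.1.le hwκ i v hw
  refine ⟨h6, by omega, fun hm => ?_⟩
  obtain ⟨a, h8, h9, h10⟩ := h5 hm
  exact h.mem_none_of_le h10 (by omega)

/-- A call writes each register at most once. -/
theorem write_unique_of_inCall (h : IsRun (algorithm Proc m) L C) {w' : ℕ} {v' : Content Proc}
    (hc : InCall L s w p .getTS) (hw : L[w]? = some (.write p i v))
    (hc' : InCall L s w' p .getTS) (hw' : L[w']? = some (.write p i v')) : w = w' := by
  rcases lt_trichotomy w w' with hlt | heq | hlt
  · exact absurd (h.history_of_write hc hw hc' hw' hlt).2.1 (lt_irrefl _)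
  · exact heq
  · exact absurd (h.history_of_write hc' hw' hc hw hlt).2.1 (lt_irrefl _)

/-- The last identifier in a register is the writer's own; it determines the call, and the call
writes this register only once. -/
theorem write_unique_of_lastOf (h : IsRun (algorithm Proc m) L C) {w' : ℕ} {p' : Proc}
    {v' : Content Proc} (hw : L[w]? = some (.write p i v)) (hw' : L[w']? = some (.write p' i v'))
    (hv : lastOf v = lastOf v') : w = w' := by
  obtain ⟨s, hc⟩ := h.exists_inCall_getTS_of_write hw
  obtain ⟨s', hc'⟩ := h.exists_inCall_getTS_of_write hw'
  rw [h.lastOf_of_write hw, h.lastOf_of_write hw', Option.some_inj] at hv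
  obtain ⟨rfl, rfl⟩ := h.inCall_eq_of_id_eq hc hc' hv
  exact h.write_unique_of_inCall hc hw hc' hw'

/-- There is no ABA problem: a register that has the same last identifier at two times has not
been written in between. -/
theorem not_writeTo_of_lastOf_eq (h : IsRun (algorithm Proc m) L C) {a b : ℕ}
    (hl : lastOf ((C a).mem i) = lastOf ((C b).mem i)) {u : ℕ} (hau : a ≤ u)
    (hub : u < b) : ¬ WriteTo L u i := by
  intro hu
  obtain ⟨w', p', h4, h5, h6, -⟩ := h.exists_last_write (a := a) (b := b) ⟨u, hau, hub, hu⟩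
  by_cases ha : (C a).mem i = none
  · rw [h.lastOf_of_write h6, ha] at hl
    simp [lastOf] at hl
  · obtain ⟨w, p, h1, h2, -⟩ := h.exists_write_of_mem_ne_none ha
    have := h.write_unique_of_lastOf h2 h6 hl
    omega

theorem mem_eq_of_lastOf_eq (h : IsRun (algorithm Proc m) L C) {a b : ℕ}
    (hl : lastOf ((C a).mem i) = lastOf ((C b).mem i)) {u : ℕ} (hau : a ≤ u)
    (hub : u ≤ b) : (C u).mem i = (C a).mem i :=
  h.mem_eq_of_no_write hau fun _ h1 h2 =>
    h.not_writeTo_of_lastOf_eq hl h1 (h2.trans_le hub)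

end IsRun

end Writes

/-! ### Atomic scans and the order of timestamps -/

section Correctness

variable {Proc : Type*}

/-- The call of `getTS` that is invoked at time `s` writes `R[φ]` at line 15 before time `n`, and its
scan returns the contents of the registers at time `σ`. -/
def ScanAt (m : ℕ) (L : List (Event Proc ℕ (Content Proc) (ℕ × ℕ)))
    (C : ℕ → Config Proc ℕ (Content Proc) (Local Proc)) (n φ σ s : ℕ) : Prop :=
  ∃ w p v view r τ κ k ψ, φ = ψ + 1 ∧ InCall L s w p .getTS ∧ L[w]? = some (.write p φ v) ∧ w < n ∧
    ((C w).loc p).pc = .line15 view ψ ∧ Loop L C p s τ κ r ψ k ∧ Quiet L p κ w ∧ ψ ≤ k ∧ κ ≤ σ ∧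
    σ ≤ w ∧ (C σ).mem φ = none ∧ ∀ i, 1 ≤ i → i ≤ m → (C σ).mem i = view i

variable [DecidableEq Proc] {m : ℕ} {L : List (Event Proc ℕ (Content Proc) (ℕ × ℕ))}
  {C : ℕ → Config Proc ℕ (Content Proc) (Local Proc)} {p : Proc} {s t w i : ℕ} {v : Content Proc}

namespace IsRun

theorem lt_myrnd_of_write (h : IsRun (algorithm Proc m) L C) (hw : L[w]? = some (.write p i v))
    (hpc : ∀ r ψ, ((C w).loc p).pc ≠ .line15 r ψ) :
    i < ((C w).loc p).pc.myrnd := by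
  obtain ⟨s, hc⟩ := h.exists_inCall_getTS_of_write hw
  have hI := h.callInv hc
  rcases h.pc_of_write hw with ⟨ψ, hpc', -⟩ | ⟨r, ψ, hpc', -⟩ | ⟨r, ψ, -, hpc', -⟩
  · rw [hpc'] at hI ⊢
    exact hI.2.1
  · rw [hpc'] at hI ⊢
    exact hI.2.1
  · exact absurd hpc' (hpc r ψ)

/-- The double collect is atomic. -/
theorem exists_scanAt (h : IsRun (algorithm Proc m) L C) {view : View Proc} {ψ : ℕ}
    (hψ : ψ + 1 ≤ m) (hc : InCall L s w p .getTS) (hpc : ((C w).loc p).pc = .line15 view ψ)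
    (hw : L[w]? = some (.write p (ψ + 1) v)) :
    ∃ σ, σ ≤ w ∧ (∀ n, w < n → ScanAt m L C n (ψ + 1) σ s) ∧ (C σ).mem (ψ + 1) = none ∧
      (∀ i, 1 ≤ i → i ≤ m → (C σ).mem i = view i) ∧ ∀ i, 1 ≤ i → i ≤ ψ → (C σ).mem i ≠ none := by
  have hI := h.callInv hc
  rw [hpc] at hI
  obtain ⟨r, τ, κ, μ, k, h3, h4, h5, h6, h7, h8, h9, h10⟩ := hI
  -- `μ` separates the two equal collects: each register showed the same content before and after
  -- `μ`, so without ABA it had that content at `μ`.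
  have hview : ∀ i, 1 ≤ i → i ≤ m → (C μ).mem i = view i := by
    intro i hi him
    obtain ⟨u, u', h11, h12, h13, h14, h15, h16⟩ := h10 i hi him
    rw [← h15]
    exact h.mem_eq_of_lastOf_eq (b := u') (by rw [h15, h16]) h12.le h13
  have hnone : (C μ).mem (ψ + 1) = none := by
    rw [hview _ (by omega) hψ, h9]
  have := h3.exit_lt
  exact ⟨μ, h8, fun n hn => ⟨w, p, v, view, r, τ, κ, k, ψ, rfl, hc, hw, hn, hpc, h3, h4, h5, h7,
    h8, hnone, hview⟩, hnone, hview, fun i hi hiψ => h.mem_ne_none_of_loop h3 hi hiψ (by omega)⟩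

/-- The content of `R[myrnd]` that a call uses in its for-loop stems from a scan. -/
theorem exists_source (h : IsRun (algorithm Proc m) L C) {τ κ ψ k n : ℕ} {r : View Proc}
    (hl : Loop L C p s τ κ r ψ k) (hψ : 1 ≤ ψ) (hψm : ψ ≤ m) (hn : τ ≤ n) :
    ∃ σ s', ScanAt m L C n ψ σ s' ∧ σ < τ ∧ (C σ).mem ψ = none ∧
      ∀ i, 1 ≤ i → i < ψ → entry (r ψ) i = lastOf ((C σ).mem i) := by
  obtain ⟨u, h1, h2, h3, h4⟩ := hl.reads ψ hψ le_rfl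
  rw [← h3] at h4
  obtain ⟨w, p', hwu, hw, -⟩ := h.exists_write_of_mem_ne_none h4
  obtain ⟨s', hc⟩ := h.exists_inCall_getTS_of_write hw
  obtain ⟨τ', κ', r', k', hl', -, h5, h6, h7, h8, -⟩ := h.loop_of_write hw hc
  have hτ := hl'.exit_lt
  -- An invalidation of `R[ψ]` would come from a call with `myrnd > ψ`, which has seen `R[ψ+1]`
  -- filled before `τ`, while the read at `τ` finds it empty. So the content stems from `line15`.
  by_cases hpc : ∀ r ψ, ((C w).loc p').pc ≠ .line15 r ψ
  · have hlt := h.lt_myrnd_of_write hw hpc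
    exact absurd hl.exit_read (h.mem_ne_none_of_loop hl' (by omega) hlt (by omega))
  · push Not at hpc
    obtain ⟨view, ψ', hpc⟩ := hpc
    obtain ⟨h9, h10⟩ : ψ = ψ' + 1 ∧
        (C u).mem ψ = some (lasts view ψ' ++ [((C w).loc p').id], ψ' + 1) := by
      rcases h.pc_of_write hw with ⟨ψ₀, hpc', -⟩ | ⟨r, ψ₀, hpc', -⟩ | ⟨r, ψ₀, h9, hpc', h10⟩
      · simp [hpc] at hpc'
      · simp [hpc] at hpc'
      · simp only [hpc, PC.line15.injEq] at hpc'
        obtain ⟨rfl, rfl⟩ := hpc'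
        exact ⟨h9, h10⟩
    subst h9
    obtain ⟨σ, h11, h12, h13, h14, h15⟩ := h.exists_scanAt hψm hc hpc hw
    refine ⟨σ, s', h12 n (by omega), by omega, h13, fun i hi hiψ => ?_⟩
    have hne : ∀ j < ψ', lastOf (view (j + 1)) ≠ none := fun j hj => by
      rw [← h14 (j + 1) (by omega) (by omega)]
      exact h.lastOf_ne_none (h15 (j + 1) (by omega) (by omega))
    obtain ⟨h16, h17⟩ := getElem?_lasts hne (i := i - 1) (by omega)
    rw [← h3, h10, h14 i hi (by omega)]
    simp only [entry, Option.bind_some]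
    rw [List.getElem?_append_left (by omega), h16, show i - 1 + 1 = i by omega]

theorem exists_ret (h : IsRun (algorithm Proc m) L C) {res : Result (ℕ × ℕ)}
    (he : L[t]? = some (.respond p res)) :
    ∃ cont, (algorithm Proc m).next ((C t).loc p) = .ret res cont := by
  have hs := h.step he
  generalize C (t + 1) = D at hs
  generalize C t = D₀ at hs
  cases hs with
  | respond _ _ cont hb hn => exact ⟨cont, hn⟩

theorem respond_getTS (h : IsRun (algorithm Proc m) L C) {res : Result (ℕ × ℕ)}
    (hc : InCall L s t p .getTS) (he : L[t]? = some (.respond p res)) :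
    ∃ x, res = .stamp x ∧ ((C t).loc p).pc = .retTS x := by
  obtain ⟨cont, hn⟩ := h.exists_ret he
  have hI := h.callInv hc
  unfold algorithm at hn
  dsimp only at hn
  split at hn <;> simp at hn
  · rename_i hpc
    rw [hpc] at hI
    exact hI.elim
  · rename_i hpc
    exact ⟨_, hn.1.symm, hpc⟩
  · rename_i hpc
    rw [hpc] at hI
    exact hI.elim

theorem respond_compare (h : IsRun (algorithm Proc m) L C) {res : Result (ℕ × ℕ)} {x y : ℕ × ℕ}
    (hc : InCall L s t p (.compare x y)) (he : L[t]? = some (.respond p res)) :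
    res = .bool (compareTS x y) := by
  obtain ⟨cont, hn⟩ := h.exists_ret he
  have hpc := h.pc_of_inCall_compare hc
  simp [algorithm, hpc] at hn
  exact hn.1.symm

/-- Timestamps of consecutive calls are ordered. -/
theorem stamp_lt (h : IsRun (algorithm Proc m) L C) (hm : ∀ t i, (C t).mem i ≠ none → i ≤ m)
    {p' : Proc} {s' t' : ℕ} {x y : ℕ × ℕ} (hc : InCall L s t p .getTS)
    (hx : ((C t).loc p).pc = .retTS x) (hc' : InCall L s' t' p' .getTS)
    (hy : ((C t').loc p').pc = .retTS y) (hlt : t < s') :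
    x.1 < y.1 ∨ (x.1 = y.1 ∧ x.2 < y.2) := by
  have hI := h.callInv hc
  have hI' := h.callInv hc'
  rw [hx] at hI
  rw [hy] at hI'
  -- Rounds do not decrease: `R[ρ]` is filled by the end of the earlier call, and the later call
  -- still sees `R[ψ+1]` empty.
  have key : ∀ {ρ ψ u τ : ℕ}, (C u).mem ρ ≠ none → (C τ).mem (ψ + 1) = none → u ≤ τ → ρ ≤ ψ := by
    intro ρ ψ u τ h1 h2 h3
    by_contra hc
    exact h.mem_ne_none_of_le (h.mem_mono h1 h3) (by omega) (by omega : ψ + 1 ≤ ρ) h2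
  rcases hI with ⟨ψ, τ, u, rfl, h1, h2, h3, h4, h5⟩ |
    ⟨ψ, j, r, τ, κ, b, c, rfl, h1, h2, h3, h4, h5, h6, h7, h8⟩
  · rcases hI' with ⟨ψ', τ', u', rfl, h1', h2', h3', h4', h5'⟩ |
      ⟨ψ', j', r', τ', κ', b', c', rfl, h1', h2', h3', h4', h5', h6', h7', h8'⟩
    · have := key h5 h3' (by omega)
      simp
      omega
    · have := h3'.start_lt
      have := key h5 h3'.exit_read (by omega)
      simp
      omega
  · have h9 := h.mem_ne_none_of_le_rndOf (by omega) h8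
    rcases hI' with ⟨ψ', τ', u', rfl, h1', h2', h3', h4', h5'⟩ |
      ⟨ψ', j', r', τ', κ', b', c', rfl, h1', h2', h3', h4', h5', h6', h7', h8'⟩
    · have := key h9 h3' (by omega)
      simp
      omega
    · have hs' := h3'.start_lt
      have := key h9 h3'.exit_read (by omega)
      rcases this.lt_or_eq with hlt' | rfl
      · exact .inl hlt'
      refine .inr ⟨rfl, ?_⟩
      by_contra hjj
      simp only [not_lt] at hjj
      -- If `j' ≤ j`, the earlier call survived iteration `j'` or returned in it; both leave a
      -- moment `d` at which `R[j']` has round at least `ψ`.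
      obtain ⟨d, hd, hdr⟩ : ∃ d ≤ t, ψ ≤ rndOf ((C d).mem j') := by
        rcases hjj.lt_or_eq with hlt' | rfl
        · obtain ⟨a, d, -, -, h10, -, h11⟩ := h3.progress j' h1' hlt'
          exact ⟨d, by omega, h11⟩
        · exact ⟨c, h6, h8⟩
      obtain ⟨σ, -, -, h10, h11, h12⟩ := h.exists_source h3' (by omega) (hm _ _ h9) le_rfl
      have hτ' := h3'.exit_lt
      have hdψ := h.mem_ne_none_of_le_rndOf (by omega) hdr
      have hσd : σ < d := by
        by_contra hc
        exact h.mem_mono hdψ (not_lt.1 hc) h11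
      -- The successful test of the later call shows that `R[j']` is unchanged from `σ` to `b'`.
      -- Hence its round was at least `ψ` already at `σ`, when `R[ψ]` was still empty.
      have heq := h.mem_eq_of_lastOf_eq (a := σ) (b := b') (i := j') (u := d)
        (by rw [← h12 j' h1' h2', h7']) hσd.le (by omega)
      rw [heq] at hdr
      exact h.mem_ne_none_of_le_rndOf (by omega) hdr h11

theorem timestampSpec (h : IsRun (algorithm Proc m) L C)
    (hm : ∀ t i, (C t).mem i ≠ none → i ≤ m) : TimestampSpec L := by
  refine ⟨?_, ?_, ?_⟩
  · rintro i j res ⟨p, h1, h2, h3, h4⟩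
    obtain ⟨x, hx, -⟩ := h.respond_getTS ⟨h1, h2, h4⟩ h3
    exact ⟨x, hx⟩
  · rintro i j x y res ⟨p, h1, h2, h3, h4⟩
    exact ⟨_, h.respond_compare ⟨h1, h2, h4⟩ h3⟩
  · rintro i₁ j₁ i₂ j₂ x y ⟨p, h1, h2, h3, h4⟩ ⟨q, h5, h6, h7, h8⟩ hlt
    obtain ⟨x', hx, hpx⟩ := h.respond_getTS ⟨h1, h2, h4⟩ h3
    obtain ⟨y', hy, hpy⟩ := h.respond_getTS ⟨h5, h6, h8⟩ h7
    cases hx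
    cases hy
    have hxy := h.stamp_lt hm ⟨h1, h2, h4⟩ hpx ⟨h5, h6, h8⟩ hpy hlt
    refine ⟨?_, ?_⟩
    · rintro i j b ⟨o, h9, h10, h11, h12⟩
      have := h.respond_compare ⟨h9, h10, h12⟩ h11
      cases this
      simpa [compareTS] using hxy
    · rintro i j b ⟨o, h9, h10, h11, h12⟩
      have := h.respond_compare ⟨h9, h10, h12⟩ h11
      cases this
      simp only [compareTS, decide_eq_false_iff_not]
      omega

end IsRun

end Correctness

/-! ### The space bound: charging register writes to calls -/

section Space

variable {Proc : Type*}

/-- For each round `φ ≤ m`, `σ φ` is the earliest time of a scan that leads to a write of `R[φ]` at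
line 15 before time `n`, and `b φ` is the call that performs this scan. -/
structure EarliestScans (m : ℕ) (L : List (Event Proc ℕ (Content Proc) (ℕ × ℕ)))
    (C : ℕ → Config Proc ℕ (Content Proc) (Local Proc)) (n : ℕ) (σ b : ℕ → ℕ) : Prop where
  scanAt : ∀ φ, 1 ≤ φ → φ ≤ m → ScanAt m L C n φ (σ φ) (b φ)
  le : ∀ φ τ s, ScanAt m L C n φ τ s → σ φ ≤ τ

/-- Time `w` lies in the `φ`-th of the intervals that are separated by `σ 1, …, σ m`. -/
def InInterval (m : ℕ) (σ : ℕ → ℕ) (φ w : ℕ) : Prop :=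
  σ φ ≤ w ∧ (φ < m → w < σ (φ + 1))

/-- Event number `w` is the last write before time `n` in the call that `p` invokes at time `s`. -/
def FinalWrite (L : List (Event Proc ℕ (Content Proc) (ℕ × ℕ))) (n s w : ℕ) (p : Proc) (i : ℕ) :
    Prop :=
  InCall L s w p .getTS ∧ w < n ∧ (∃ v, L[w]? = some (.write p i v)) ∧
    ∀ w' i' v', w < w' → w' < n → InCall L s w' p .getTS → L[w']? ≠ some (.write p i' v')

/-- The relation that charges register `j` in interval `φ` (or, for `j = 0`, the call `b φ`) to one
of two slots of a call. -/
inductive Charge (m : ℕ) (L : List (Event Proc ℕ (Content Proc) (ℕ × ℕ)))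
    (C : ℕ → Config Proc ℕ (Content Proc) (Local Proc)) (n : ℕ) (σ b : ℕ → ℕ) :
    ℕ → ℕ → ℕ → Bool → Prop where
  -- Slot `true` is paid by the final write of the call. `first` and `late` exclude each other,
  -- since `w` is or is not the first write to `R[j]` in its interval. A late write pays for the
  -- interval after its own.
  | first {φ j s w : ℕ} {p : Proc} (hw : FinalWrite L n s w p j) (hφ : InInterval m σ φ w)
      (hfirst : ∀ u, σ φ ≤ u → u < w → ¬ WriteTo L u j) : Charge m L C n σ b φ j s true
  | late {φ j s w u : ℕ} {p : Proc} (hw : FinalWrite L n s w p j) (h1 : 1 ≤ φ) (hm : φ + 1 ≤ m)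
      (hφ : InInterval m σ φ w) (hu : σ φ ≤ u) (huw : u < w) (hw' : WriteTo L u j) :
      Charge m L C n σ b (φ + 1) j s true
  -- Slot `false` is used by calls that open a round, and by calls with an invalidation that
  -- straddles the start of the next round.
  | scanner (φ : ℕ) : Charge m L C n σ b φ 0 (b φ) false
  | straddle {φ j s w a : ℕ} {p : Proc} {r : View Proc} {v : Content Proc}
      (hc : InCall L s w p .getTS) (hw : L[w]? = some (.write p j v))
      (hpc : ((C w).loc p).pc = .line11 r φ j) (ha : a < σ (φ + 1)) (hσ : σ (φ + 1) ≤ w)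
      (hq : Quiet L p a w) : Charge m L C n σ b (φ + 1) j s false

variable [DecidableEq Proc] {m : ℕ} {L : List (Event Proc ℕ (Content Proc) (ℕ × ℕ))}
  {C : ℕ → Config Proc ℕ (Content Proc) (Local Proc)} {p : Proc} {n s t w i : ℕ}
  {v : Content Proc} {σ b : ℕ → ℕ}

namespace IsRun

theorem lt_of_mem_ne_none (h : IsRun (algorithm Proc m) L C) (hm : 1 ≤ m)
    (hn : ∀ t < n, (C t).mem m = none) (ht : t < n) (hi : (C t).mem i ≠ none) : i < m := by
  by_contra hc
  exact h.mem_ne_none_of_le hi hm (not_lt.1 hc) (hn t ht)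

theorem myrnd_lt_of_write (h : IsRun (algorithm Proc m) L C) (hm : 1 ≤ m)
    (hn : ∀ t < n, (C t).mem m = none) (hwn : w < n) (hw : L[w]? = some (.write p i v)) :
    ((C w).loc p).pc.myrnd < m := by
  obtain ⟨s, hc⟩ := h.exists_inCall_getTS_of_write hw
  obtain ⟨τ, κ, r, k, hl, -, h1, -⟩ := h.loop_of_write hw hc
  rcases Nat.eq_zero_or_pos ((C w).loc p).pc.myrnd with h0 | h0
  · omega
  · have := hl.exit_lt
    exact h.lt_of_mem_ne_none hm hn hwn (h.mem_ne_none_of_loop hl h0 le_rfl (by omega))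

theorem scanAt_spec (h : IsRun (algorithm Proc m) L C) {φ τ : ℕ} (hs : ScanAt m L C n φ τ s) :
    1 ≤ φ ∧ τ < n ∧ (C τ).mem φ = none ∧ ∀ i, 1 ≤ i → i < φ → (C τ).mem i ≠ none := by
  obtain ⟨w, p, v, view, r, τ', κ, k, ψ, rfl, h1, h2, h3, h4, h5, h6, h7, h8, h9, h10, h11⟩ := hs
  have := h5.exit_lt
  exact ⟨by omega, by omega, h10, fun i hi hiψ =>
    h.mem_ne_none_of_loop h5 hi (by omega) (by omega)⟩

/-- The first write to `R[φ]` must be at `line15`, because a call that invalidates `R[φ]` has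
already seen it filled; and a write at `line15` rests on a scan. -/
theorem exists_earliestScans (h : IsRun (algorithm Proc m) L C) (hnm : (C n).mem m ≠ none) :
    ∃ σ b, EarliestScans m L C n σ b := by
  classical
  have hex : ∀ φ, 1 ≤ φ → φ ≤ m → ∃ τ s, ScanAt m L C n φ τ s := by
    intro φ h1 hφ
    have hφn := h.mem_ne_none_of_le hnm h1 hφ
    have hP : ∃ t, (C (t + 1)).mem φ ≠ none := by
      rcases n with _ | n
      · simp [h.zero, Implementation.init, algorithm] at hφn
      · exact ⟨n, hφn⟩
    have hw := Nat.find_spec hP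
    have hlt : Nat.find hP < n := by
      by_contra hc
      have := Nat.find_min hP (m := n - 1)
      rcases n with _ | n
      · simp [h.zero, Implementation.init, algorithm] at hφn
      · exact this (by omega) hφn
    have hnone : (C (Nat.find hP)).mem φ = none := by
      rcases hk : Nat.find hP with _ | k
      · simp [h.zero, Implementation.init, algorithm]
      · by_contra hc
        exact Nat.find_min hP (m := k) (by omega) hc
    generalize Nat.find hP = w at *
    obtain ⟨p, v, hwr⟩ : WriteTo L w φ := by
      by_contra hc
      rw [h.mem_succ_of_not_writeTo hc] at hw
      exact hw hnone
    obtain ⟨s, hc⟩ := h.exists_inCall_getTS_of_write hwr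
    by_cases hpc : ∀ r ψ, ((C w).loc p).pc ≠ .line15 r ψ
    · obtain ⟨τ, κ, r, k, hl, -, h2, -⟩ := h.loop_of_write hwr hc
      have := hl.exit_lt
      exact absurd hnone (h.mem_ne_none_of_loop hl h1 (h.lt_myrnd_of_write hwr hpc).le (by omega))
    · push Not at hpc
      obtain ⟨r, ψ, hpc⟩ := hpc
      obtain rfl : φ = ψ + 1 := by
        rcases h.pc_of_write hwr with ⟨_, hpc', -⟩ | ⟨_, _, hpc', -⟩ | ⟨_, _, h3, hpc', -⟩ <;>
          simp_all
      obtain ⟨τ, -, h3, -⟩ := h.exists_scanAt hφ hc hpc hwr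
      exact ⟨τ, s, h3 n hlt⟩
  have hmin : ∀ φ, ∃ τ s, (1 ≤ φ → φ ≤ m → ScanAt m L C n φ τ s) ∧
      ∀ τ' s', ScanAt m L C n φ τ' s' → τ ≤ τ' := by
    intro φ
    by_cases hφ : ∃ τ s, ScanAt m L C n φ τ s
    · obtain ⟨s, hs⟩ := Nat.find_spec hφ
      exact ⟨Nat.find hφ, s, fun _ _ => hs, fun τ' s' h' => Nat.find_min' hφ ⟨s', h'⟩⟩
    · exact ⟨0, 0, fun h1 h2 => absurd (hex φ h1 h2) hφ, fun _ _ _ => Nat.zero_le _⟩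
  choose σ b hσ using hmin
  exact ⟨σ, b, fun φ => (hσ φ).1, fun φ => (hσ φ).2⟩

/-- `R[φ]` is empty at `σ φ` but filled at `σ φ'`, where a larger register is about to be opened. -/
theorem earliest_lt (h : IsRun (algorithm Proc m) L C) (hσ : EarliestScans m L C n σ b) {φ φ' : ℕ}
    (h1 : 1 ≤ φ) (hlt : φ < φ') (hm : φ' ≤ m) : σ φ < σ φ' := by
  obtain ⟨-, -, h2, -⟩ := h.scanAt_spec (hσ.scanAt φ h1 (by omega))
  obtain ⟨-, -, -, h3⟩ := h.scanAt_spec (hσ.scanAt φ' (by omega) hm)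
  by_contra hc
  exact h.mem_mono (h3 φ h1 hlt) (not_lt.1 hc) h2

theorem interval_unique (h : IsRun (algorithm Proc m) L C) (hσ : EarliestScans m L C n σ b)
    {φ φ' : ℕ} (h1 : 1 ≤ φ) (h1' : 1 ≤ φ') (hm : φ ≤ m) (hm' : φ' ≤ m) (hw : InInterval m σ φ w)
    (hw' : InInterval m σ φ' w) : φ = φ' := by
  have key : ∀ {x y : ℕ}, 1 ≤ x → y ≤ m → InInterval m σ x w → InInterval m σ y w → ¬ x < y := by
    intro x y hx hy hxw hyw hlt
    have h2 := hxw.2 (by omega)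
    have h3 := hyw.1
    rcases Nat.lt_or_ge (x + 1) y with h4 | h4
    · have := h.earliest_lt hσ (by omega) h4 hy
      omega
    · obtain rfl : y = x + 1 := by omega
      omega
  have := key h1 hm' hw hw'
  have := key h1' hm hw' hw
  omega

/-- The sequence in `r[ψ]` records `R[i]` at a scan that opened round `ψ`, hence not before `σ ψ`; a
mismatch at time `a` betrays a write since then. -/
theorem exists_writeTo_of_entry_ne (h : IsRun (algorithm Proc m) L C)
    (hσ : EarliestScans m L C n σ b) {τ κ ψ k a : ℕ} {r : View Proc}
    (hl : Loop L C p s τ κ r ψ k) (hψm : ψ ≤ m) (hn : τ ≤ n) (ha : τ < a) (hi : 1 ≤ i)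
    (hiψ : i < ψ) (hne : entry (r ψ) i ≠ lastOf ((C a).mem i)) :
    ∃ u, σ ψ ≤ u ∧ u < a ∧ WriteTo L u i := by
  obtain ⟨τ', s', h1, h2, -, h4⟩ := h.exists_source hl (by omega) hψm hn
  obtain ⟨u, h5, h6, h7⟩ := h.exists_write_of_ne (a := τ') (b := a) (j := i) (by omega)
    fun hc => hne (by rw [h4 i hi hiψ, hc])
  exact ⟨u, (hσ.le _ _ _ h1).trans h5, h6, h7⟩

/-- For `j < φ`, the call that scans at `σ (φ + 1)` survived iteration `j`, so it found `R[j]`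
changed since a scan of round `φ`. For `j = φ`, the register is empty at `σ φ` and filled at the end
of the interval. No scan follows the last interval, which leaves only `j = m` there. -/
theorem exists_first_write (h : IsRun (algorithm Proc m) L C) (hnm : (C n).mem m ≠ none)
    (hσ : EarliestScans m L C n σ b) {φ j : ℕ} (hj : 1 ≤ j) (hφm : φ ≤ m)
    (hjφ : j < φ ∧ φ < m ∨ j = φ) :
    ∃ w, w < n ∧ InInterval m σ φ w ∧ WriteTo L w j ∧
      ∀ u, σ φ ≤ u → u < w → ¬ WriteTo L u j := by
  classical
  have hex : ∃ w, σ φ ≤ w ∧ (w < n ∧ (φ < m → w < σ (φ + 1))) ∧ WriteTo L w j := by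
    rcases hjφ with ⟨hlt, hφ⟩ | rfl
    · obtain ⟨w, p, v, view, r, τ, κ, k, ψ, hψ, h1, h2, h3, h4, h5, h6, h7, h8, h9, h10, h11⟩ :=
        hσ.scanAt (φ + 1) (by omega) hφ
      obtain rfl : φ = ψ := by omega
      have := h5.exit_lt
      obtain ⟨a, a', h12, h13, h14, h15, -⟩ := h5.progress j hj (by omega)
      obtain ⟨u, h16, h17, h18⟩ :=
        h.exists_writeTo_of_entry_ne hσ h5 hφm (by omega) h12 hj hlt h15
      exact ⟨u, h16, ⟨by omega, fun _ => by omega⟩, h18⟩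
    · obtain ⟨-, h1, h2, -⟩ := h.scanAt_spec (hσ.scanAt j hj hφm)
      by_cases hjm : j < m
      · obtain ⟨-, h3, -, h4⟩ := h.scanAt_spec (hσ.scanAt (j + 1) (by omega) hjm)
        obtain ⟨u, h5, h6, h7⟩ := h.exists_write_of_ne (a := σ j) (b := σ (j + 1)) (j := j)
          (h.earliest_lt hσ hj j.lt_succ_self hjm).le
          (by rw [h2]; exact (h4 j hj j.lt_succ_self).symm)
        exact ⟨u, h5, ⟨by omega, fun _ => h6⟩, h7⟩
      · obtain ⟨u, h5, h6, h7⟩ := h.exists_write_of_ne (a := σ j) (b := n) (j := j) h1.le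
          (by rw [h2]; exact (h.mem_ne_none_of_le hnm hj hφm).symm)
        exact ⟨u, h5, ⟨h6, fun hc => absurd hc hjm⟩, h7⟩
  obtain ⟨h1, h2, h3⟩ := Nat.find_spec hex
  refine ⟨Nat.find hex, h2.1, ⟨h1, h2.2⟩, h3, fun u hu huw hc => ?_⟩
  exact Nat.find_min hex huw ⟨hu, ⟨by omega, fun h4 => by have := h2.2 h4; omega⟩, hc⟩

/-- A write that is not the last one of its call is at line 11, and not late. -/
theorem finalWrite_or (h : IsRun (algorithm Proc m) L C) (hm : 1 ≤ m)
    (hn : ∀ t < n, (C t).mem m = none) (hc : InCall L s w p .getTS) (hwn : w < n)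
    (hw : L[w]? = some (.write p i v)) :
    FinalWrite L n s w p i ∨
      ∃ r ψ, ((C w).loc p).pc = .line11 r ψ i ∧ (C w).mem (ψ + 1) = none := by
  by_cases hf : ∀ w' i' v', w < w' → w' < n → InCall L s w' p .getTS →
      L[w']? ≠ some (.write p i' v')
  · exact .inl ⟨hc, hwn, ⟨v, hw⟩, hf⟩
  · push Not at hf
    obtain ⟨w', i', v', h1, h2, h3, h4⟩ := hf
    obtain ⟨⟨r, h5⟩, -, h6⟩ := h.history_of_write hc hw h3 h4 h1
    -- Since `myrnd < m` before time `n`, the check preceding the later write, be it `line6` or the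
    -- scan, does cover `R[myrnd + 1]` and finds it empty; so it was empty at `w`.
    exact .inr ⟨r, _, h5, h6 (.inl (h.myrnd_lt_of_write hm hn h2 h4))⟩

/-- The first write `w` to `R[j]` in the interval pays if it is final in its call. Otherwise it is
an invalidation with `R[ψ]` filled and `R[ψ+1]` empty, where `ψ` is the caller's `myrnd`, which
forces `ψ = φ` or `ψ + 1 = φ`. -/
theorem exists_charge (h : IsRun (algorithm Proc m) L C) (hm : 1 ≤ m)
    (hn : ∀ t < n, (C t).mem m = none) (hnm : (C n).mem m ≠ none)
    (hσ : EarliestScans m L C n σ b) {φ j : ℕ} (hj : 1 ≤ j) (hφm : φ ≤ m)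
    (hjφ : j < φ ∧ φ < m ∨ j = φ) :
    ∃ s x, (∃ p, L[s]? = some (.invoke p .getTS)) ∧ Charge m L C n σ b φ j s x := by
  obtain ⟨w, hwn, hφw, ⟨p, v, hw⟩, hfirst⟩ := h.exists_first_write hnm hσ hj hφm hjφ
  obtain ⟨s, hc⟩ := h.exists_inCall_getTS_of_write hw
  rcases h.finalWrite_or hm hn hc hwn hw with hf | ⟨r, ψ, hpc, hnone⟩
  · exact ⟨s, true, ⟨p, hc.2.1⟩, .first hf hφw hfirst⟩
  have hI := h.callInv hc
  rw [hpc] at hI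
  obtain ⟨-, hjψ, τ, κ, a, e, c, hl, hq, h3, h4, h5, h6, h7, h8, h9⟩ := hI
  have hτ := hl.exit_lt
  have hwψ := h.mem_ne_none_of_loop hl (by omega) le_rfl (t := w) (by omega)
  have hψm := h.lt_of_mem_ne_none hm hn hwn hwψ
  obtain ⟨-, -, -, h10⟩ := h.scanAt_spec (hσ.scanAt φ (by omega) hφm)
  have hle : φ ≤ ψ + 1 := by
    by_contra hlt
    exact h.mem_mono (h10 (ψ + 1) (by omega) (by omega)) hφw.1 hnone
  have hge : ψ ≤ φ := by
    by_contra hlt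
    obtain ⟨-, -, h11, -⟩ := h.scanAt_spec (hσ.scanAt (φ + 1) (by omega) (by omega))
    exact h.mem_mono (h.mem_ne_none_of_le hwψ (by omega) (by omega)) (hφw.2 (by omega)).le h11
  -- If `ψ = φ`, the mismatch seen at `line7` reveals an earlier write to `R[j]` in the same
  -- interval, so `w` was not the first.
  rcases hge.eq_or_lt with rfl | hlt
  · obtain ⟨u, h11, h12, h13⟩ :=
      h.exists_writeTo_of_entry_ne hσ hl hψm.le (by omega) (by omega) hj hjψ h8
    exact absurd h13 (hfirst u h11 (by omega))
  obtain rfl : φ = ψ + 1 := by omega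
  by_cases hcσ : c < σ (ψ + 1)
  · exact ⟨s, false, ⟨p, hc.2.1⟩, .straddle hc hw hpc hcσ hφw.1
      fun u hu => hq u (by omega)⟩
  -- The round below `ψ` read at `c` was thus in `R[j]` already at `σ (ψ + 1)`. But the call
  -- scanning then had seen a round of at least `ψ` there at `e'`, so a write `d` in between put an
  -- outdated round back. It is not the first in its interval: the mismatch at `a'` gives an earlier
  -- write `u`.
  have hmem : (C c).mem j = (C (σ (ψ + 1))).mem j :=
    h.mem_eq_of_no_write (not_lt.1 hcσ) fun u h11 h12 => hfirst u h11 (by omega)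
  rw [hmem] at h9
  obtain ⟨w', q, v', view, r', τ', κ', k', ψ', hψ', g1, g2, g3, g4, g5, g6, g7, g8, g9, g10, g11⟩ :=
    hσ.scanAt (ψ + 1) (by omega) hφm
  obtain rfl : ψ = ψ' := by omega
  have hτ' := g5.exit_lt
  obtain ⟨a', e', f1, f2, f3, f4, f5⟩ := g5.progress j hj (by omega)
  obtain ⟨u, f6, f7, f8⟩ := h.exists_writeTo_of_entry_ne hσ g5 hψm.le (by omega) f1 hj hjψ f4
  obtain ⟨d, q', f9, f10, f11, -⟩ := h.exists_last_write_of_ne (a := e') (b := σ (ψ + 1)) (j := j)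
    (by omega) (fun hc => by rw [hc] at f5; omega)
  obtain ⟨s', hc'⟩ := h.exists_inCall_getTS_of_write f11
  rcases h.finalWrite_or hm hn hc' (by omega) f11 with hf | ⟨r'', ψ'', hpc'', hnone''⟩
  · exact ⟨s', true, ⟨q', hc'.2.1⟩, .late hf (by omega) hφm ⟨by omega, fun _ => f10⟩ f6 (by omega)
      f8⟩
  -- A non-final `d` would need `R[ψ''+1]` empty although `ψ'' + 1 ≤ ψ` and `R[ψ]` is filled.
  · have hrnd : rndOf ((C (σ (ψ + 1))).mem j) = ψ'' := by
      rcases h.pc_of_write f11 with ⟨_, e1, -⟩ | ⟨_, _, e1, e2⟩ | ⟨_, _, -, e1, -⟩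
      · simp [hpc''] at e1
      · rw [hpc''] at e1
        simp only [PC.line11.injEq] at e1
        simp [e2, rndOf, e1]
      · simp [hpc''] at e1
    exact absurd hnone'' (h.mem_ne_none_of_loop g5 (by omega) (by omega) (by omega))

/-- A call has one final write, which lies in one interval and is first there or not; this settles
slot `true`. For slot `false`, the write at `line15` is unique in its call, `myrnd` is fixed
throughout a call, and at most one write of a call can straddle `σ (myrnd + 1)`. -/
theorem charge_unique (h : IsRun (algorithm Proc m) L C) (hσ : EarliestScans m L C n σ b)
    {φ j φ' j' : ℕ} {x : Bool} (h1 : 1 ≤ φ) (h1' : 1 ≤ φ') (hm : φ ≤ m) (hm' : φ' ≤ m)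
    (hc : Charge m L C n σ b φ j s x) (hc' : Charge m L C n σ b φ' j' s x) :
    φ = φ' ∧ j = j' := by
  have hproc : ∀ {w w' : ℕ} {p p' : Proc}, InCall L s w p .getTS → InCall L s w' p' .getTS →
      p = p' := by
    intro w w' p p' hp hp'
    have := hp.2.1.symm.trans hp'.2.1
    simpa using this
  have hfin : ∀ {w w' i i' : ℕ} {p p' : Proc}, FinalWrite L n s w p i →
      FinalWrite L n s w' p' i' → w = w' ∧ i = i' := by
    intro w w' i i' p p' hw hw'
    obtain rfl := hproc hw.1 hw'.1
    obtain ⟨a1, a2, ⟨v, a3⟩, a4⟩ := hw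
    obtain ⟨b1, b2, ⟨v', b3⟩, b4⟩ := hw'
    rcases lt_trichotomy w w' with hlt | rfl | hlt
    · exact absurd b3 (a4 w' i' v' hlt b2 b1)
    · rw [a3] at b3
      simp at b3
      exact ⟨rfl, b3.1⟩
    · exact absurd a3 (b4 w i v hlt a2 a1)
  -- A call that opens round `φ` by the scan at `σ φ` has made all its invalidations before that
  -- scan, whereas a straddling write comes at or after `σ (φ' + 1)`, which is the same time as
  -- `myrnd` agrees.
  have hscan : ∀ {φ φ' w j : ℕ} {p : Proc} {r : View Proc} {v : Content Proc}, 1 ≤ φ → φ ≤ m →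
      b φ = s → InCall L s w p .getTS → L[w]? = some (.write p j v) →
      ((C w).loc p).pc = .line11 r φ' j → σ (φ' + 1) ≤ w → False := by
    intro φ φ' w j p r v hφ hφm hb hc hw hpc hσw
    obtain ⟨w', q, v', view, r', τ', κ', k', ψ, rfl, g1, g2, g3, g4, g5, g6, g7, g8, g9, g10,
      g11⟩ := hσ.scanAt φ hφ hφm
    rw [hb] at g1 g5
    obtain rfl := hproc hc g1
    rcases lt_trichotomy w w' with hlt | rfl | hlt
    · have hwκ := g6.lt_of_write hlt hw
      obtain ⟨⟨r'', e1⟩, -⟩ := g5.history w hc.1.le hwκ _ _ hw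
      rw [hpc] at e1
      simp only [PC.line11.injEq] at e1
      rw [← e1.2.1] at g8
      omega
    · simp [hpc] at g4
    · obtain ⟨⟨r'', e1⟩, -⟩ := h.history_of_write g1 g2 hc hw hlt
      simp [g4] at e1
  cases hc with
  | first hw hφ hfirst =>
    cases hc' with
    | first hw' hφ' hfirst' =>
      obtain ⟨rfl, rfl⟩ := hfin hw hw'
      exact ⟨h.interval_unique hσ h1 h1' hm hm' hφ hφ', rfl⟩
    | late hw' h2 h3 hφ' hu huw hwu =>
      obtain ⟨rfl, rfl⟩ := hfin hw hw'
      obtain rfl := h.interval_unique hσ h1 h2 hm (by omega) hφ hφ'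
      exact absurd hwu (hfirst _ hu huw)
  | late hw h2 h3 hφ hu huw hwu =>
    cases hc' with
    | first hw' hφ' hfirst' =>
      obtain ⟨rfl, rfl⟩ := hfin hw hw'
      obtain rfl := h.interval_unique hσ h1' h2 hm' (by omega) hφ' hφ
      exact absurd hwu (hfirst' _ hu huw)
    | late hw' h2' h3' hφ' hu' huw' hwu' =>
      obtain ⟨rfl, rfl⟩ := hfin hw hw'
      obtain rfl := h.interval_unique hσ h2 h2' (by omega) (by omega) hφ hφ'
      exact ⟨rfl, rfl⟩
  | scanner =>
    generalize hs : b φ = s at *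
    cases hc' with
    | scanner =>
      obtain ⟨w, q, v, view, r, τ, κ, k, ψ, e1, g1, g2, g3, g4, -⟩ := hσ.scanAt φ h1 hm
      obtain ⟨w', q', v', view', r', τ', κ', k', ψ', e1', g1', g2', g3', g4', -⟩ :=
        hσ.scanAt φ' h1' hm'
      rw [hs] at g1
      obtain rfl := hproc g1 g1'
      refine ⟨?_, rfl⟩
      rcases lt_trichotomy w w' with hlt | rfl | hlt
      · obtain ⟨⟨_, e2⟩, -⟩ := h.history_of_write g1 g2 g1' g2' hlt
        simp [g4] at e2
      · rw [g2] at g2'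
        simp at g2'
        exact g2'.1
      · obtain ⟨⟨_, e2⟩, -⟩ := h.history_of_write g1' g2' g1 g2 hlt
        simp [g4'] at e2
    | straddle hc hw hpc ha hσw hq => exact (hscan h1 hm hs hc hw hpc hσw).elim
  | straddle hc hw hpc ha hσw hq =>
    generalize hs : s = s₀ at hc'
    cases hc' with
    | scanner => exact (hscan h1' hm' hs.symm hc hw hpc hσw).elim
    | straddle hc' hw' hpc' ha' hσw' hq' =>
      subst hs
      obtain rfl := hproc hc hc'
      rename_i φ w a p r v φ' w' a' r' v'
      -- Both writes straddle the same time. The quiet stretch before the later one begins before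
      -- that time, so it would contain the earlier one.
      rcases lt_trichotomy w w' with hlt | rfl | hlt
      · obtain ⟨⟨_, e2⟩, -⟩ := h.history_of_write hc hw hc' hw' hlt
        rw [hpc, hpc'] at e2
        simp only [PC.line11.injEq, PC.myrnd] at e2
        have := hq'.lt_of_write hlt hw
        rw [e2.2.1] at hσw
        omega
      · rw [hpc] at hpc'
        simp only [PC.line11.injEq] at hpc'
        exact ⟨by omega, hpc'.2.2⟩
      · obtain ⟨⟨_, e2⟩, -⟩ := h.history_of_write hc' hw' hc hw hlt
        rw [hpc, hpc'] at e2
        simp only [PC.line11.injEq, PC.myrnd] at e2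
        have := hq.lt_of_write hlt hw'
        rw [e2.2.1] at hσw'
        omega

/-- The pairs that are charged: all registers `j ≤ φ` in the intervals `φ < m`, the register `m` in
the last interval, and, with `j = 0`, one call per interval. -/
theorem card_charged (k : ℕ) : 2 * ((Finset.Icc 1 (k + 1)).sigma fun φ =>
    if φ < k + 1 then Finset.range (φ + 1) else {0, k + 1}).card =
      (k + 1) * (k + 1) + (k + 1) + 2 := by
  rw [Finset.card_sigma, Finset.sum_Icc_succ_top (by omega)]
  have : ∀ k', k' ≤ k → 2 * ∑ φ ∈ Finset.Icc 1 k', (if φ < k + 1 then Finset.range (φ + 1)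
      else {0, k + 1}).card = k' * k' + 3 * k' := by
    intro k' hk'
    induction k' with
    | zero => simp
    | succ k' ih =>
      rw [Finset.sum_Icc_succ_top (by omega), mul_add, ih (by omega), if_pos (by omega),
        Finset.card_range]
      ring
  rw [mul_add, this k le_rfl, if_neg (lt_irrefl _), Finset.card_pair (by omega)]
  ring

/-- The space bound: writing `R[m]` takes more than `m² / 4` calls of `getTS`. -/
theorem four_mul_card_ge (h : IsRun (algorithm Proc m) L C) (hm : 1 ≤ m)
    (hn : ∀ t < n, (C t).mem m = none) (hnm : (C n).mem m ≠ none) {S : Finset ℕ}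
    (hS : ∀ s p, L[s]? = some (.invoke p .getTS) → s ∈ S) : m * m + m + 2 ≤ 4 * S.card := by
  obtain ⟨σ, b, hσ⟩ := h.exists_earliestScans hnm
  obtain ⟨k, rfl⟩ : ∃ k, m = k + 1 := ⟨m - 1, by omega⟩
  -- Every pair gets one of `2 * S.card` slots and no slot serves two pairs. The `m` pairs with `j =
  -- 0` are essential: without them the count gives only `m² - m + 2 ≤ 4 * S.card`.
  have hcard := Finset.card_le_card_of_forall_subsingleton
    (s := (Finset.Icc 1 (k + 1)).sigma fun φ =>
      if φ < k + 1 then Finset.range (φ + 1) else {0, k + 1})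
    (t := S ×ˢ (Finset.univ : Finset Bool))
    (fun x y => Charge (k + 1) L C n σ b x.1 x.2 y.1 y.2) ?_ ?_
  · have := card_charged k
    rw [Finset.card_product, Finset.card_univ, Fintype.card_bool] at hcard
    omega
  · rintro ⟨φ, j⟩ hx
    simp only [Finset.mem_sigma, Finset.mem_Icc] at hx
    obtain ⟨⟨h1, hφm⟩, hj⟩ := hx
    rcases Nat.eq_zero_or_pos j with rfl | hj0
    · obtain ⟨w, p, v, view, r, τ, κ, l, ψ, -, g1, -⟩ := hσ.scanAt φ h1 hφm
      exact ⟨(b φ, false), by simpa using hS _ p g1.2.1, .scanner φ⟩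
    · obtain ⟨s, x, ⟨p, hp⟩, hch⟩ := h.exists_charge hm hn hnm hσ (φ := φ) (j := j) hj0 hφm (by
        split_ifs at hj with hlt
        · simp at hj
          omega
        · simp at hj
          omega)
      exact ⟨(s, x), by simpa using hS _ p hp, hch⟩
  · rintro ⟨s, x⟩ - ⟨φ, j⟩ ⟨hx, hc⟩ ⟨φ', j'⟩ ⟨hx', hc'⟩
    simp only [Finset.mem_sigma, Finset.mem_Icc] at hx hx'
    obtain ⟨rfl, rfl⟩ := h.charge_unique hσ hx.1.1 hx'.1.1 hx.1.2 hx'.1.2 hc hc'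
    rfl

end IsRun

end Space

/-! ### Counting invocations, writes and own steps -/

section Counting

theorem card_filter_getElem? {α : Type*} (q : α → Bool) (L : List α) :
    ((Finset.range L.length).filter fun t => L[t]?.any q = true).card = L.countP q := by
  induction L using List.reverseRecOn with
  | nil => simp
  | append_singleton L a ih =>
    rw [List.length_append, List.length_singleton, Finset.range_add_one, Finset.filter_insert,
      List.countP_append, ← ih]
    have hcongr : (Finset.range L.length).filter (fun t => (L ++ [a])[t]?.any q = true) =
        (Finset.range L.length).filter fun t => L[t]?.any q = true := by
      refine Finset.filter_congr fun t ht => ?_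
      rw [List.getElem?_append_left (Finset.mem_range.1 ht)]
    rw [hcongr]
    by_cases hq : q a
    · simp [hq]
    · simp [hq]

variable {Proc : Type*} {L : List (Event Proc ℕ (Content Proc) (ℕ × ℕ))}

/-- The times at which `getTS` is invoked. -/
def getTSTimes (L : List (Event Proc ℕ (Content Proc) (ℕ × ℕ))) : Finset ℕ :=
  (Finset.range L.length).filter fun t => L[t]?.any (fun e => e.isGetTS) = true

theorem card_getTSTimes_le {M : ℕ} (hM : AtMostGetTS M L) : (getTSTimes L).card ≤ M := by
  rw [getTSTimes, card_filter_getElem?]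
  exact hM

theorem mem_getTSTimes {s : ℕ} {p : Proc} (hs : L[s]? = some (.invoke p .getTS)) :
    s ∈ getTSTimes L := by
  have := (List.getElem?_eq_some_iff.1 hs).1
  rw [getTSTimes, Finset.mem_filter, hs]
  exact ⟨Finset.mem_range.2 this, rfl⟩

open Classical in
/-- The number of writes before time `t`. -/
noncomputable def writes (L : List (Event Proc ℕ (Content Proc) (ℕ × ℕ))) (t : ℕ) : ℕ :=
  ((Finset.range t).filter fun u => ∃ j, WriteTo L u j).card

theorem writes_mono {a b : ℕ} (hab : a ≤ b) : writes L a ≤ writes L b := by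
  classical
  exact Finset.card_le_card (Finset.filter_subset_filter _ (Finset.range_subset_range.2 hab))

theorem writes_lt {a b u j : ℕ} (hau : a ≤ u) (hub : u < b) (hu : WriteTo L u j) :
    writes L a < writes L b := by
  classical
  refine Finset.card_lt_card (Finset.ssubset_iff.2 ⟨u, ?_, ?_⟩)
  · simp
    omega
  · refine Finset.insert_subset ?_
      (Finset.filter_subset_filter _ (Finset.range_subset_range.2 (by omega)))
    simp [hub]
    exact ⟨j, hu⟩

variable [DecidableEq Proc]

/-- The number of steps of `p` in the time interval `(s, t)`. -/
def ownSteps (L : List (Event Proc ℕ (Content Proc) (ℕ × ℕ))) (p : Proc) (s t : ℕ) : ℕ :=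
  ((Finset.range t).filter fun u => s < u ∧ L[u]?.any (fun e => decide (e.proc = p)) = true).card

theorem ownSteps_self (p : Proc) (s : ℕ) : ownSteps L p s (s + 1) = 0 := by
  simp only [ownSteps, Finset.card_eq_zero, Finset.filter_eq_empty_iff, Finset.mem_range]
  intro u hu hc
  omega

theorem ownSteps_succ_le (p : Proc) (s t : ℕ) : ownSteps L p s (t + 1) ≤ ownSteps L p s t + 1 := by
  rw [ownSteps, Finset.range_add_one, Finset.filter_insert]
  split_ifs
  · exact Finset.card_insert_le _ _
  · exact Nat.le_succ _

theorem ownSteps_succ_of_ne {p : Proc} {s t : ℕ} (hp : ∀ e, L[t]? = some e → e.proc ≠ p) :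
    ownSteps L p s (t + 1) = ownSteps L p s t := by
  rw [ownSteps, Finset.range_add_one, Finset.filter_insert, if_neg, ownSteps]
  rintro ⟨-, h⟩
  rcases he : L[t]? with _ | e
  · simp [he] at h
  · simp [he] at h
    exact hp e he h

theorem countP_le_ownSteps {L₁ L₂ : List (Event Proc ℕ (Content Proc) (ℕ × ℕ))} {p : Proc}
    {e : Event Proc ℕ (Content Proc) (ℕ × ℕ)} (hL : L = L₁ ++ e :: L₂) :
    L₂.countP (fun e => decide (e.proc = p)) ≤ ownSteps L p L₁.length L.length := by
  rw [← card_filter_getElem?]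
  refine Finset.card_le_card_of_injOn (fun u => L₁.length + 1 + u) ?_ ?_
  · intro u hu
    simp only [Finset.coe_filter, Finset.mem_range, Set.mem_ofPred_eq] at hu ⊢
    subst hL
    refine ⟨by simp; omega, by omega, ?_⟩
    rw [List.getElem?_append_right (by omega), show L₁.length + 1 + u - L₁.length = u + 1 by omega]
    simpa using hu.2
  · intro u _ u' _ huu
    simpa using huu

end Counting

/-! ### Wait-freedom: bounding the steps of a call -/

section WaitFreedom

variable {Proc : Type*} [DecidableEq Proc] {m : ℕ}
  {L : List (Event Proc ℕ (Content Proc) (ℕ × ℕ))}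
  {C : ℕ → Config Proc ℕ (Content Proc) (Local Proc)} {p : Proc} {s t i : ℕ}

/-- Bounds on the number of steps that a call of `getTS` by `p`, invoked at time `s`, has taken
before time `t`, at each point of its program. -/
def StepBound (m : ℕ) (L : List (Event Proc ℕ (Content Proc) (ℕ × ℕ)))
    (C : ℕ → Config Proc ℕ (Content Proc) (Local Proc)) (p : Proc) (s t : ℕ) : PC Proc → Prop
  | .idle => False
  -- Each filled register costs two reads in the first loop, whose exit costs one more; an iteration
  -- of the for-loop takes at most four steps.
  | .line1 _ j => ownSteps L p s t ≤ 2 * (j - 1)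
  | .line2 _ j => ownSteps L p s t ≤ 2 * (j - 1) + 1
  | .line6 _ ψ j => ownSteps L p s t ≤ 2 * ψ + 1 + 4 * (j - 1)
  | .line7 _ ψ j => ownSteps L p s t ≤ 2 * ψ + 1 + 4 * (j - 1) + 1
  | .line8 ψ j => ownSteps L p s t ≤ 2 * ψ + 1 + 4 * (j - 1) + 2
  | .line10 _ ψ j => ownSteps L p s t ≤ 2 * ψ + 1 + 4 * (j - 1) + 2
  | .line11 _ ψ j => ownSteps L p s t ≤ 2 * ψ + 1 + 4 * (j - 1) + 3
  -- `c` counts the finished collects, the last of which occupied `[μ', μ)`. One write can spoil two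
  -- comparisons, so the potential is the sum of the write counts at two consecutive starts: after a
  -- failed comparison some write lies in `[μ', t]`, and moving from `(μ', μ)` to `(μ, t + 1)`
  -- raises the sum.
  | .line13 _ prev cur j => ∃ c μ, ownSteps L p s t ≤ 6 * m + 1 + c * m + (j - 1) ∧ μ ≤ t ∧
      (∀ i, 1 ≤ i → i < j → ∃ u, μ ≤ u ∧ u < t ∧ (C u).mem i = cur i) ∧
      (prev = none ∧ c = 0 ∨ ∃ old μ', prev = some old ∧ μ' ≤ μ ∧
        c ≤ writes L μ' + writes L μ + 1 ∧
        ∀ i, 1 ≤ i → i ≤ m → ∃ u, μ' ≤ u ∧ u < μ ∧ (C u).mem i = old i)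
  | .line15 _ _ => ownSteps L p s t ≤ 6 * m + 2 + (2 * writes L t + 2) * m
  | .retTS _ => ownSteps L p s t ≤ 6 * m + 3 + (2 * writes L t + 2) * m
  | .compare _ _ => False

theorem StepBound.frame {pc : PC Proc} (h : StepBound m L C p s t pc)
    (hp : ∀ e, L[t]? = some e → e.proc ≠ p) : StepBound m L C p s (t + 1) pc := by
  have hw : (2 * writes L t + 2) * m ≤ (2 * writes L (t + 1) + 2) * m :=
    Nat.mul_le_mul_right _ (by have := writes_mono (L := L) (Nat.le_add_right t 1); omega)
  cases pc <;> simp only [StepBound, ownSteps_succ_of_ne hp] at h ⊢ <;> try omega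
  obtain ⟨c, μ, h1, h2, h3, h4⟩ := h
  refine ⟨c, μ, h1, by omega, fun i hi hij => ?_, h4⟩
  obtain ⟨u, h5, h6, h7⟩ := h3 i hi hij
  exact ⟨u, h5, by omega, h7⟩

theorem stepBound_forLoop {r : View Proc} {ψ j : ℕ} (hψ : ψ < m) (hj : j ≤ ψ + 1)
    (h : ownSteps L p s t ≤ 2 * ψ + 1 + 4 * (j - 1)) : StepBound m L C p s t (forLoop r ψ j) := by
  unfold forLoop
  split_ifs
  · exact h
  · exact ⟨0, t, by omega, le_rfl, fun i hi hi' => by omega, .inl ⟨rfl, rfl⟩⟩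

namespace IsRun

theorem myrnd_lt_of_loop (h : IsRun (algorithm Proc m) L C)
    (hm : ∀ t i, (C t).mem i ≠ none → i < m) (hm1 : 1 ≤ m) {τ κ ψ k : ℕ} {r : View Proc}
    (hl : Loop L C p s τ κ r ψ k) : ψ < m := by
  rcases Nat.eq_zero_or_pos ψ with h0 | h0
  · omega
  · exact hm τ ψ (h.mem_ne_none_of_loop hl h0 le_rfl le_rfl)

theorem stepBound_read (h : IsRun (algorithm Proc m) L C)
    (hm : ∀ t i, (C t).mem i ≠ none → i < m) (hm1 : 1 ≤ m) (hc : InCall L s t p .getTS)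
    {cont : Content Proc → Local Proc}
    (hn : (algorithm Proc m).next ((C t).loc p) = .read i cont)
    (hB : StepBound m L C p s t ((C t).loc p).pc) :
    StepBound m L C p s (t + 1) (cont ((C t).mem i)).pc := by
  have hstep := ownSteps_succ_le (L := L) p s t
  have hwm := writes_mono (L := L) (Nat.le_add_right t 1)
  have hI := h.callInv hc
  cases hpc : ((C t).loc p).pc with
  | idle => simp [algorithm, hpc] at hn
  | compare => simp [algorithm, hpc] at hn
  | retTS => simp [algorithm, hpc] at hn
  | line8 => simp [algorithm, hpc] at hn
  | line11 => simp [algorithm, hpc] at hn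
  | line15 => simp [algorithm, hpc] at hn
  | line1 r j =>
    simp [algorithm, hpc] at hn
    obtain ⟨rfl, rfl⟩ := hn
    rw [hpc] at hB hI
    simp only [StepBound] at hB
    obtain ⟨h1, -, h2⟩ := hI
    dsimp only
    split_ifs with hv
    · refine stepBound_forLoop ?_ (by omega) (by omega)
      rcases Nat.lt_or_ge 1 j with hj | hj
      · obtain ⟨u, -, -, h3, h4⟩ := h2 (j - 1) (by omega) (by omega)
        exact hm u _ (h3 ▸ h4)
      · omega
    · simp only [StepBound]
      omega
  | line2 r j =>
    simp [algorithm, hpc] at hn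
    obtain ⟨rfl, rfl⟩ := hn
    rw [hpc] at hB hI
    obtain ⟨h1, -⟩ := hI
    simp only [StepBound] at hB ⊢
    omega
  | line6 r ψ j =>
    simp [algorithm, hpc] at hn
    obtain ⟨rfl, rfl⟩ := hn
    rw [hpc] at hB hI
    obtain ⟨h1, h2, τ, κ, hl, -⟩ := hI
    have := h.myrnd_lt_of_loop hm hm1 hl
    dsimp only
    split_ifs with hv
    · simp only [StepBound] at hB ⊢
      omega
    · simp only [StepBound] at hB ⊢
      omega
  | line7 r ψ j =>
    simp [algorithm, hpc] at hn
    obtain ⟨rfl, rfl⟩ := hn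
    rw [hpc] at hB
    dsimp only
    split_ifs with hv
    · simp only [StepBound] at hB ⊢
      omega
    · simp only [StepBound] at hB ⊢
      omega
  | line10 r ψ j =>
    simp [algorithm, hpc] at hn
    obtain ⟨rfl, rfl⟩ := hn
    rw [hpc] at hB hI
    obtain ⟨h1, h2, τ, κ, a, b, hl, -⟩ := hI
    have := h.myrnd_lt_of_loop hm hm1 hl
    simp only [StepBound] at hB
    dsimp only
    split_ifs with hv
    · simp only [StepBound]
      omega
    · exact stepBound_forLoop this (by omega) (by omega)
  | line13 ψ prev cur j =>
    simp [algorithm, hpc] at hn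
    obtain ⟨rfl, rfl⟩ := hn
    rw [hpc] at hB hI
    obtain ⟨h1, h2, -⟩ := hI
    have hjm := h2 hm1
    obtain ⟨c, μ, h3, h4, h5, h6⟩ := hB
    set view := Function.update cur j ((C t).mem j) with hview
    have hcur : ∀ i, 1 ≤ i → i < j + 1 → ∃ u, μ ≤ u ∧ u < t + 1 ∧ (C u).mem i = view i := by
      intro i hi hij
      by_cases hij' : i = j
      · subst hij'
        exact ⟨t, h4, t.lt_succ_self, by simp [hview]⟩
      · obtain ⟨u, h12, h13, h14⟩ := h5 i hi (by omega)
        exact ⟨u, h12, by omega, by simpa [hview, hij'] using h14⟩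
    have hc1 : c ≤ 2 * writes L (t + 1) + 1 := by
      rcases h6 with ⟨-, rfl⟩ | ⟨old, μ', -, h7, h8, -⟩
      · omega
      · have := writes_mono (L := L) (show μ' ≤ t + 1 by omega)
        have := writes_mono (L := L) (show μ ≤ t + 1 by omega)
        omega
    have hc2 : c * m ≤ (2 * writes L (t + 1) + 1) * m := Nat.mul_le_mul_right _ hc1
    have hc3 : (2 * writes L (t + 1) + 2) * m = (2 * writes L (t + 1) + 1) * m + m := by ring
    simp only [afterScanRead]
    rw [← hview]
    split_ifs with hj hold hnone
    · exact ⟨c, μ, by omega, by omega, hcur, h6⟩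
    · simp only [StepBound]
      omega
    · simp only [StepBound]
      omega
    · have hcm : (c + 1) * m = c * m + m := by ring
      refine ⟨c + 1, t + 1, by omega, le_rfl, fun i hi hi' => by omega,
        .inr ⟨view, μ, rfl, by omega, ?_, fun i hi him => hcur i hi (by omega)⟩⟩
      rcases h6 with ⟨-, rfl⟩ | ⟨old, μ', rfl, h7, h8, h9⟩
      · omega
      · have hne : ∃ i, 1 ≤ i ∧ i ≤ m ∧ old i ≠ view i := by
          by_contra! hcon
          exact hold ⟨old, rfl, fun i hi => hcon i (Finset.mem_Icc.1 hi).1 (Finset.mem_Icc.1 hi).2⟩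
        obtain ⟨i, hi, him, hne⟩ := hne
        obtain ⟨u, h10, h11, h12⟩ := h9 i hi him
        obtain ⟨u', h13, h14, h15⟩ := hcur i hi (by omega)
        obtain ⟨w, h16, h17, h18⟩ := h.exists_write_of_ne (a := u) (b := u') (j := i) (by omega)
          (by rwa [h12, h15])
        have := writes_lt (L := L) (a := μ') (b := t + 1) (by omega) (by omega) h18
        omega

theorem stepBound_write (h : IsRun (algorithm Proc m) L C)
    (hm : ∀ t i, (C t).mem i ≠ none → i < m) (hm1 : 1 ≤ m) (hc : InCall L s t p .getTS)
    {v : Content Proc} {cont : Local Proc}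
    (hn : (algorithm Proc m).next ((C t).loc p) = .write i v cont)
    (hB : StepBound m L C p s t ((C t).loc p).pc) : StepBound m L C p s (t + 1) cont.pc := by
  have hstep := ownSteps_succ_le (L := L) p s t
  have hwm := writes_mono (L := L) (Nat.le_add_right t 1)
  have hI := h.callInv hc
  cases hpc : ((C t).loc p).pc with
  | idle => simp [algorithm, hpc] at hn
  | compare => simp [algorithm, hpc] at hn
  | retTS => simp [algorithm, hpc] at hn
  | line1 => simp [algorithm, hpc] at hn
  | line2 => simp [algorithm, hpc] at hn
  | line6 => simp [algorithm, hpc] at hn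
  | line7 => simp [algorithm, hpc] at hn
  | line10 => simp [algorithm, hpc] at hn
  | line13 => simp [algorithm, hpc] at hn
  | line8 ψ j =>
    simp [algorithm, hpc] at hn
    obtain ⟨rfl, rfl, rfl⟩ := hn
    rw [hpc] at hB hI
    obtain ⟨h1, h2, r, τ, κ, a, b, hl, -⟩ := hI
    have := h.myrnd_lt_of_loop hm hm1 hl
    simp only [StepBound] at hB ⊢
    omega
  | line11 r ψ j =>
    simp [algorithm, hpc] at hn
    obtain ⟨rfl, rfl, rfl⟩ := hn
    rw [hpc] at hB hI
    obtain ⟨h1, h2, τ, κ, a, b, c, hl, -⟩ := hI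
    simp only [StepBound] at hB
    exact stepBound_forLoop (h.myrnd_lt_of_loop hm hm1 hl) (by omega) (by omega)
  | line15 view ψ =>
    simp [algorithm, hpc] at hn
    obtain ⟨rfl, rfl, rfl⟩ := hn
    rw [hpc] at hB
    have hw : (2 * writes L t + 2) * m ≤ (2 * writes L (t + 1) + 2) * m :=
      Nat.mul_le_mul_right _ (by omega)
    simp only [StepBound] at hB ⊢
    omega

theorem stepBound (h : IsRun (algorithm Proc m) L C)
    (hm : ∀ t i, (C t).mem i ≠ none → i < m) (hm1 : 1 ≤ m) (hc : InCall L s t p .getTS) :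
    StepBound m L C p s t ((C t).loc p).pc := by
  refine h.inCall_induction (Q := fun t st => StepBound m L C p s t st.pc) ?_ ?_ ?_ ?_ hc
  · exact (ownSteps_self p s).le
  · exact fun t st _ hp hQ => hQ.frame hp
  · exact fun t r cont hc _ hn hQ => h.stepBound_read hm hm1 hc hn hQ
  · exact fun t r v cont hc _ hn hQ => h.stepBound_write hm hm1 hc hn hQ

/-- A write is determined by its call and its register. -/
theorem writes_le (h : IsRun (algorithm Proc m) L C) (hm : ∀ t i, (C t).mem i ≠ none → i < m) :
    writes L t ≤ (getTSTimes L).card * m := by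
  classical
  have hcard := Finset.card_le_card_of_forall_subsingleton
    (s := (Finset.range t).filter fun u => ∃ j, WriteTo L u j)
    (t := getTSTimes L ×ˢ Finset.range m)
    (fun w y => ∃ p v, InCall L y.1 w p .getTS ∧ L[w]? = some (.write p y.2 v)) ?_ ?_
  · rwa [Finset.card_product, Finset.card_range] at hcard
  · intro w hw
    obtain ⟨j, p, v, hw⟩ := (Finset.mem_filter.1 hw).2
    obtain ⟨s, hc⟩ := h.exists_inCall_getTS_of_write hw
    refine ⟨(s, j), ?_, p, v, hc, hw⟩
    have hj : j < m := hm (w + 1) j (by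
      rw [h.mem_succ_of_write hw]
      exact h.write_ne_none hw)
    simpa [hj] using mem_getTSTimes hc.2.1
  · rintro ⟨s, j⟩ - w ⟨-, p, v, hc, hw⟩ w' ⟨-, p', v', hc', hw'⟩
    have := hc.2.1.symm.trans hc'.2.1
    obtain rfl : p = p' := by simpa using this
    exact h.write_unique_of_inCall hc hw hc' hw'

theorem ownSteps_le (h : IsRun (algorithm Proc m) L C)
    (hm : ∀ t i, (C t).mem i ≠ none → i < m) (hm1 : 1 ≤ m) (hc : InCall L s t p .getTS) :
    ownSteps L p s t ≤ 6 * m + 3 + (2 * ((getTSTimes L).card * m) + 2) * m := by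
  have hB := h.stepBound hm hm1 hc
  have hI := h.callInv hc
  have hW := h.writes_le hm (t := t)
  set W := (getTSTimes L).card * m
  have hw : (2 * writes L t + 2) * m ≤ (2 * W + 2) * m := Nat.mul_le_mul_right _ (by omega)
  cases hpc : ((C t).loc p).pc with
  | idle =>
    rw [hpc] at hB
    exact hB.elim
  | compare =>
    rw [hpc] at hB
    exact hB.elim
  | line1 r j =>
    rw [hpc] at hB hI
    obtain ⟨h1, -, h2⟩ := hI
    simp only [StepBound] at hB
    rcases Nat.lt_or_ge 1 j with hj | hj
    · obtain ⟨u, -, -, h3, h4⟩ := h2 (j - 1) (by omega) (by omega)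
      have := hm u _ (h3 ▸ h4)
      omega
    · omega
  | line2 r j =>
    rw [hpc] at hB hI
    obtain ⟨h1, -, ⟨u, -, -, h2⟩, -⟩ := hI
    have := hm u j h2
    simp only [StepBound] at hB
    omega
  | line6 r ψ j =>
    rw [hpc] at hB hI
    obtain ⟨h1, h2, τ, κ, hl, -⟩ := hI
    have := h.myrnd_lt_of_loop hm hm1 hl
    simp only [StepBound] at hB
    omega
  | line7 r ψ j =>
    rw [hpc] at hB hI
    obtain ⟨h1, h2, τ, κ, a, hl, -⟩ := hI
    have := h.myrnd_lt_of_loop hm hm1 hl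
    simp only [StepBound] at hB
    omega
  | line8 ψ j =>
    rw [hpc] at hB hI
    obtain ⟨h1, h2, r, τ, κ, a, b, hl, -⟩ := hI
    have := h.myrnd_lt_of_loop hm hm1 hl
    simp only [StepBound] at hB
    omega
  | line10 r ψ j =>
    rw [hpc] at hB hI
    obtain ⟨h1, h2, τ, κ, a, b, hl, -⟩ := hI
    have := h.myrnd_lt_of_loop hm hm1 hl
    simp only [StepBound] at hB
    omega
  | line11 r ψ j =>
    rw [hpc] at hB hI
    obtain ⟨h1, h2, τ, κ, a, b, c, hl, -⟩ := hI
    have := h.myrnd_lt_of_loop hm hm1 hl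
    simp only [StepBound] at hB
    omega
  | line13 ψ prev cur j =>
    rw [hpc] at hB hI
    have hjm := hI.2.1 hm1
    obtain ⟨c, μ, h3, h4, -, h6⟩ := hB
    have hc1 : c ≤ 2 * W + 1 := by
      rcases h6 with ⟨-, rfl⟩ | ⟨old, μ', -, h7, h8, -⟩
      · omega
      · have := h.writes_le hm (t := μ')
        have := h.writes_le hm (t := μ)
        omega
    have hc2 : c * m ≤ (2 * W + 1) * m := Nat.mul_le_mul_right _ hc1
    have hc3 : (2 * W + 2) * m = (2 * W + 1) * m + m := by ring
    omega
  | line15 =>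
    rw [hpc] at hB
    simp only [StepBound] at hB
    omega
  | retTS =>
    rw [hpc] at hB
    simp only [StepBound] at hB
    omega

end IsRun

end WaitFreedom

/-! ### Assembling the theorem -/

section Main

variable {Proc : Type*} {m M : ℕ}
  {L : List (Event Proc ℕ (Content Proc) (ℕ × ℕ))}
  {C : ℕ → Config Proc ℕ (Content Proc) (Local Proc)} {p : Proc} {s t i : ℕ}

/-- Excludes the degenerate case `m = 0`, in which a call of `getTS` would still read `R[1]`: a
single invocation forces `1 ≤ M`. -/
theorem one_le_of_invoke (hM : AtMostGetTS M L) (hMm : 4 * M ≤ m * m)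
    (hs : L[s]? = some (.invoke p .getTS)) : 1 ≤ m := by
  have h1 := card_getTSTimes_le hM
  have h2 := Finset.card_pos.2 ⟨s, mem_getTSTimes hs⟩
  by_contra hc
  obtain rfl : m = 0 := by omega
  omega

variable [DecidableEq Proc]

namespace IsRun

/-- At most `m - 1` registers are ever written. -/
theorem lt_of_atMostGetTS (h : IsRun (algorithm Proc m) L C) (hM : AtMostGetTS M L)
    (hMm : 4 * M ≤ m * m) : ∀ t i, (C t).mem i ≠ none → i < m := by
  intro t i hi
  obtain ⟨w, p, -, hw, -⟩ := h.exists_write_of_mem_ne_none hi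
  obtain ⟨s, hc⟩ := h.exists_inCall_getTS_of_write hw
  have hm1 := one_le_of_invoke hM hMm hc.2.1
  have hnone : ∀ n, (C n).mem m = none := by
    intro n
    induction n using Nat.strong_induction_on with
    | _ n ih =>
      by_contra hnm
      -- At the first time at which `R[m]` is filled, `m² + m + 2 ≤ 4 * M ≤ m²`, which is absurd.
      have h1 := h.four_mul_card_ge hm1 ih hnm (S := getTSTimes L) fun s p => mem_getTSTimes
      have h2 := card_getTSTimes_le hM
      omega
  by_contra hc
  exact h.mem_ne_none_of_le hi hm1 (not_lt.1 hc) (hnone t)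

/-- Filled registers have index below `m`, and outside the scan a call reads at most one register
beyond those it has seen filled. So `R[m]` may be read, but it is never written. -/
theorem reg_mem_Icc (h : IsRun (algorithm Proc m) L C) (hM : AtMostGetTS M L)
    (hMm : 4 * M ≤ m * m) {e : Event Proc ℕ (Content Proc) (ℕ × ℕ)} (he : L[t]? = some e)
    (hi : e.reg? = some i) : i ∈ Finset.Icc 1 m := by
  have hm := h.lt_of_atMostGetTS hM hMm
  rw [Finset.mem_Icc]
  cases e with
  | invoke => simp [Event.reg?] at hi
  | respond => simp [Event.reg?] at hi
  | write p r v =>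
    obtain rfl : r = i := by simpa [Event.reg?] using hi
    have hne : (C (t + 1)).mem r ≠ none := by
      rw [h.mem_succ_of_write he]
      exact h.write_ne_none he
    exact ⟨h.one_le_of_mem_ne_none hne, (hm _ _ hne).le⟩
  | read p r v =>
    obtain rfl : r = i := by simpa [Event.reg?] using hi
    have hs := h.step he
    have hbn : (C t).busy p = true ∧
        ∃ cont, (algorithm Proc m).next ((C t).loc p) = .read r cont := by
      generalize C (t + 1) = D at hs
      generalize C t = D₀ at hs
      cases hs with
      | read _ _ cont hb hn => exact ⟨hb, cont, hn⟩
    obtain ⟨hb, cont, hn⟩ := hbn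
    obtain ⟨s, op, hc⟩ := h.exists_inCall hb
    cases op with
    | compare x y => simp [algorithm, h.pc_of_inCall_compare hc] at hn
    | getTS =>
      have hm1 := one_le_of_invoke hM hMm hc.2.1
      have hI := h.callInv hc
      cases hpc : ((C t).loc p).pc <;> simp [algorithm, hpc] at hn <;> rw [hpc] at hI <;>
        obtain ⟨rfl, -⟩ := hn
      · obtain ⟨h1, -, h2⟩ := hI
        rename_i j
        rcases Nat.lt_or_ge 1 j with hj | hj
        · obtain ⟨u, -, -, h3, h4⟩ := h2 (j - 1) (by omega) (by omega)
          have := hm u _ (h3 ▸ h4)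
          omega
        · omega
      · obtain ⟨h1, -, ⟨u, -, -, h2⟩, -⟩ := hI
        exact ⟨h1, (hm u _ h2).le⟩
      · obtain ⟨h1, h2, τ, κ, hl, -⟩ := hI
        have := h.myrnd_lt_of_loop hm hm1 hl
        omega
      · obtain ⟨h1, h2, τ, κ, a, hl, -⟩ := hI
        have := h.myrnd_lt_of_loop hm hm1 hl
        omega
      · obtain ⟨h1, h2, τ, κ, a, b, hl, -⟩ := hI
        have := h.myrnd_lt_of_loop hm hm1 hl
        omega
      · exact ⟨hI.1, hI.2.1 hm1⟩

/-- The only step of `compare` is its response, so its caller takes none while it is pending. -/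
theorem proc_ne_of_inCall_compare (h : IsRun (algorithm Proc m) L C) {x y : ℕ × ℕ}
    (hc : InCall L s t p (.compare x y)) {u : ℕ} (hu : s < u) (hut : u < t)
    {e : Event Proc ℕ (Content Proc) (ℕ × ℕ)} (he : L[u]? = some e) : e.proc ≠ p := by
  intro hep
  have hcu := hc.mono hu hut.le
  have hpc := h.pc_of_inCall_compare hcu
  cases e with
  | invoke q op =>
    obtain rfl : q = p := hep
    exact h.not_invoke_of_inCall hcu he
  | respond q res =>
    obtain rfl : q = p := hep
    exact hc.2.2 u hu hut res he
  | read q r v =>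
    obtain rfl : q = p := hep
    have hs := h.step he
    generalize C (u + 1) = D at hs
    generalize C u = D₀ at hs hpc
    cases hs with
    | read _ _ cont hb hn => simp [algorithm, hpc] at hn
  | write q r v =>
    obtain rfl : q = p := hep
    have hs := h.step he
    generalize C (u + 1) = D at hs
    generalize C u = D₀ at hs hpc
    cases hs with
    | write _ _ _ cont hb hn => simp [algorithm, hpc] at hn

end IsRun

theorem algorithm_implementsTimestamps (hMm : 4 * M ≤ m * m) :
    (algorithm Proc m).ImplementsTimestamps (AtMostGetTS M) := by
  intro L hL hM
  obtain ⟨C, h⟩ := hL.exists_isRun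
  exact h.timestampSpec fun t i hi => (h.lt_of_atMostGetTS hM hMm t i hi).le

theorem algorithm_accessesOnly (hMm : 4 * M ≤ m * m) :
    (algorithm Proc m).AccessesOnly (AtMostGetTS M) (Finset.Icc 1 m) := by
  intro L hL hM e he r hr
  obtain ⟨C, h⟩ := hL.exists_isRun
  obtain ⟨t, ht⟩ := List.mem_iff_getElem?.1 he
  exact h.reg_mem_Icc hM hMm ht hr

theorem algorithm_waitFree (hMm : 4 * M ≤ m * m) :
    (algorithm Proc m).WaitFree (AtMostGetTS M) := by
  refine ⟨6 * m + 3 + (2 * (M * m) + 2) * m, fun L₁ L₂ p op hL hM hres => ?_⟩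
  obtain ⟨C, h⟩ := hL.exists_isRun
  set L := L₁ ++ .invoke p op :: L₂ with hLdef
  have hget : ∀ u, L[L₁.length + 1 + u]? = L₂[u]? := by
    intro u
    rw [hLdef, List.getElem?_append_right (by omega),
      show L₁.length + 1 + u - L₁.length = u + 1 by omega]
    simp
  have hc : InCall L L₁.length L.length p op := by
    refine ⟨by simp [hLdef], by simp [hLdef], fun u hu _ res he => ?_⟩
    obtain ⟨k, rfl⟩ := Nat.exists_eq_add_of_le (show L₁.length + 1 ≤ u from hu)
    rw [hget] at he
    have := hres _ (List.mem_of_getElem? he) rfl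
    simp [Event.isResponse] at this
  cases op with
  | compare x y =>
    have hz : L₂.countP (fun e => decide (e.proc = p)) = 0 := by
      rw [List.countP_eq_zero]
      intro e he
      obtain ⟨u, hu⟩ := List.mem_iff_getElem?.1 he
      have hlt := (List.getElem?_eq_some_iff.1 hu).1
      have := h.proc_ne_of_inCall_compare hc (u := L₁.length + 1 + u) (by omega)
        (by simp [hLdef]; omega) (by rw [hget, hu])
      simpa using this
    omega
  | getTS =>
    have hm1 := one_le_of_invoke hM hMm hc.2.1
    refine (countP_le_ownSteps hLdef).trans
      ((h.ownSteps_le (h.lt_of_atMostGetTS hM hMm) hm1 hc).trans ?_)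
    have := card_getTSTimes_le hM
    gcongr

theorem OneShot.atMostGetTS {n : ℕ} {Val T : Type*} {L : List (Event (Fin n) ℕ Val T)}
    (hL : OneShot L) : AtMostGetTS n L := by
  have key : ∀ L : List (Event (Fin n) ℕ Val T), L.countP (fun e => e.isGetTS) =
      ∑ p, L.countP fun e => e.isGetTS && decide (e.proc = p) := by
    intro L
    induction L with
    | nil => simp
    | cons e L ih =>
      simp only [List.countP_cons, Finset.sum_add_distrib, ih]
      congr 1
      cases e.isGetTS <;> simp
  rw [AtMostGetTS, key]
  refine (Finset.sum_le_sum fun p _ => hL p).trans ?_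
  simp

theorem four_mul_le_ceil_sq (M : ℕ) :
    4 * M ≤ ⌈2 * Real.sqrt (M : ℝ)⌉₊ * ⌈2 * Real.sqrt (M : ℝ)⌉₊ := by
  have h1 : 2 * Real.sqrt (M : ℝ) ≤ (⌈2 * Real.sqrt (M : ℝ)⌉₊ : ℝ) := Nat.le_ceil _
  have h2 : (0 : ℝ) ≤ 2 * Real.sqrt (M : ℝ) := by positivity
  have h3 := mul_le_mul h1 h1 h2 (h2.trans h1)
  have h4 : 2 * Real.sqrt (M : ℝ) * (2 * Real.sqrt (M : ℝ)) = 4 * M := by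
    have := Real.mul_self_sqrt (Nat.cast_nonneg (α := ℝ) M)
    linear_combination 4 * this
  rw [h4] at h3
  exact_mod_cast h3

theorem ceil_two_mul_le (x : ℝ) : ⌈2 * x⌉₊ ≤ 2 * ⌈x⌉₊ := by
  rw [Nat.ceil_le]
  push_cast
  have := Nat.le_ceil x
  linarith

end Main

end TimestampObject

theorem theorem3 :
    (∀ (n : ℕ), ∃ (Val T State : Type)
        (I : TimestampObject.Implementation (Fin n) ℕ Val T State),
      I.ImplementsTimestamps TimestampObject.OneShot ∧
      I.WaitFree TimestampObject.OneShot ∧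
      I.UsesAtMost TimestampObject.OneShot ⌈2 * Real.sqrt (n : ℝ)⌉₊ ∧
      I.UsesAtMost TimestampObject.OneShot (2 * ⌈Real.sqrt (n : ℝ)⌉₊)) ∧
    (∀ (M : ℕ) (Proc : Type*) [DecidableEq Proc],
      (TimestampObject.algorithm Proc ⌈2 * Real.sqrt (M : ℝ)⌉₊).ImplementsTimestamps
        (TimestampObject.AtMostGetTS M) ∧
      (TimestampObject.algorithm Proc ⌈2 * Real.sqrt (M : ℝ)⌉₊).WaitFree
        (TimestampObject.AtMostGetTS M) ∧
      (TimestampObject.algorithm Proc ⌈2 * Real.sqrt (M : ℝ)⌉₊).AccessesOnly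
        (TimestampObject.AtMostGetTS M) (Finset.Icc 1 ⌈2 * Real.sqrt (M : ℝ)⌉₊)) := by
  refine ⟨fun n => ?_, fun M Proc _ => ?_⟩
  · have hn := TimestampObject.four_mul_le_ceil_sq n
    have hacc : (TimestampObject.algorithm (Fin n) ⌈2 * Real.sqrt (n : ℝ)⌉₊).AccessesOnly
        TimestampObject.OneShot (Finset.Icc 1 ⌈2 * Real.sqrt (n : ℝ)⌉₊) :=
      fun L hL hone => TimestampObject.algorithm_accessesOnly hn L hL hone.atMostGetTS
    obtain ⟨B, hB⟩ := TimestampObject.algorithm_waitFree (Proc := Fin n) hn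
    exact ⟨_, _, _, TimestampObject.algorithm (Fin n) ⌈2 * Real.sqrt (n : ℝ)⌉₊,
      fun L hL hone => TimestampObject.algorithm_implementsTimestamps hn L hL hone.atMostGetTS,
      ⟨B, fun L₁ L₂ p op hL hone => hB L₁ L₂ p op hL hone.atMostGetTS⟩,
      ⟨_, by simp, hacc⟩,
      ⟨_, by simpa using TimestampObject.ceil_two_mul_le _, hacc⟩⟩
  · have hM := TimestampObject.four_mul_le_ceil_sq M
    exact ⟨TimestampObject.algorithm_implementsTimestamps hM,
      TimestampObject.algorithm_waitFree hM, TimestampObject.algorithm_accessesOnly hM⟩
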